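/- **Model.** There are $K\ge 2$ arms with Bernoulli rewards of unknown means $1>\mu[1]>\mu[2]>\dots>\mu[K]\ge 0$ (all rewards independent); put $\Delta=\mu[1]-\mu[2]$. Over a time horizon $[0,T]$, $T\ge 2$, an algorithm plays arms $k(t_i)$ at times $0=t_0<t_1<t_2<\cdots$, where both may depend on the rewards seen so far; two consecutive plays at distance $\Delta t$ incur the sampling cost $1/\Delta t$. Its payoff is $P(T)=\sum_{i:\,t_i\le T}\big(\mu[k(t_i)]-\tfrac{1}{t_i-t_{i-1}}\big)$, and its expected regret is $\mathcal R=P^\star(T)-\mathbb E[P(T)]$, with the oracle payoff $P^\star(T)=\max_{N\in\mathbb N}\big(\mu[1]N-N^2/T\big)$. **Algorithm CTMAB**, with inputs $T$, $\kappa>1$, $0<\epsilon<1$, $\delta=1/T^2$, $\nu_m>0$ (it knows neither the means nor $\Delta$). *Estimation period.* In phase $i=1,2,\dots$, occupying $[T^{(i-1)\epsilon},T^{i\epsilon}]$ (for $i=1$: $[0,T^{\epsilon}]$), every arm is played $N_i=\lceil\kappa\,\log T\;T^{\frac23 i\epsilon}\rceil$ times: the $KN_i$ plays are equally spaced and form $N_i$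 rounds, in each of which every arm is played once. The period ends after the first round at which, with $q$ the number of plays of each arm so far and $\hat\mu[k]$ the empirical means, $\sqrt{\log(2/\delta)/q}<\hat\mu[k]/2$ for some arm $k$. Let $\hat\mu[1]$ denote the largest empirical mean at that time. *Identification period.* LUCB1 is run on fresh rewards, with accuracy $0$ and confidence $1-\delta$, at one play per $1/\hat\mu[1]$ time: every arm is played once; then in rounds $t=1,2,\dots$, with $u_a$ the number of plays of arm $a$ in this period, $\hat p_a$ their mean, and $\beta_a=\sqrt{\tfrac{1}{2u_a}\log\tfrac{5Kt^4}{4\delta}}$, let $h$ maximize $\hat p_a$ and let $l\ne h$ maximize $\hat p_a+\beta_a$ over $a\neq h$; if $\hat p_l+\beta_l<\hat p_h-\beta_h$, the period ends and $k^\star=h$, otherwise $h$ and $l$ are played once each. *Exploit period.* Only $k^\star$ is played, in successive phases of width $T^{\nu_m}$: with $\hat\mu$ the empirical mean of all rewards of $k^\star$ in all periods up to the beginning of the phase, $k^\star$ is played $\hat\mu\,T^{\nu_m}/2$ times at equal distances $2/\hat\mu$ (a non-integer number is rounded up, keeping the distance, and the phase ends with its last play). All plays after time $T$ are discarded. **Theorem.**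 Fix constants $\kappa>1$, $c>1$, $w>0$. There is a constant $C$, depending only on $\kappa,c,w$, such that whenever $T^{\epsilon}=c$ and the exploit phases have width $T^{\nu_m}\le w/\mu[1]^3$ (for instance, constant width $T^{\nu_m}\le w$), the number of plays up to time $T$ is finite, the payoff is integrable, and $$\mathcal R\le C\max\Big\{\frac{\mu[1]K}{\Delta^2}\log T,\ \frac{K^2}{\mu[1]}\log^2T,\ \frac{\log^2T}{\mu[1]}\Big\}\Big(1-\frac1{T^{1+\nu_m}}\Big)\Big(1-\frac1{T^2}\Big)+C\,T\Big(1-\Big(1-\frac1{T^{1+\nu_m}}\Big)\Big(1-\frac1{T^2}\Big)\Big).$$ Moreover, if $\dfrac{K}{\mu[1]}\le A\,\dfrac{\mu[1]}{\Delta^2}$, then $\mathcal R\le C'\,\dfrac{K\mu[1]\log^2T}{\Delta^2}$ with $C'$ depending only on $A,\kappa,c,w$. -/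

import Mathlib

open MeasureTheory ProbabilityTheory

noncomputable section

namespace CTMAB

/-! The continuous-time bandit with `K` arms, sampling cost `1 / Δt`, and the algorithm CTMAB. -/

/-- A table of binary rewards: `x a n` is the reward of the `(n + 1)`-st play of arm `a`. -/
abbrev Rewards (K : ℕ) := Fin K → ℕ → Bool

/-- Empirical mean of the first `n` rewards of arm `a`. -/
def empMean {K : ℕ} (x : Rewards K) (a : Fin K) (n : ℕ) : ℝ :=
  (∑ j ∈ Finset.range n, if x a j then (1 : ℝ) else 0) / n

/-- The rewards that remain after the first `q` plays of every arm. -/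
def Rewards.drop {K : ℕ} (x : Rewards K) (q : ℕ) : Rewards K := fun a n => x a (q + n)

/-- A maximizer of `f` on `s` (some maximizer, if there are several). -/
def argmaxOn {K : ℕ} [NeZero K] (s : Finset (Fin K)) (f : Fin K → ℝ) : Fin K :=
  open Classical in
  if h : s.Nonempty then Classical.choose (s.exists_max_image f h) else 0

lemma argmaxOn_spec {K : ℕ} [NeZero K] (s : Finset (Fin K)) (f : Fin K → ℝ) (h : s.Nonempty) :
    argmaxOn s f ∈ s ∧ ∀ a ∈ s, f a ≤ f (argmaxOn s f) := by
  unfold argmaxOn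
  rw [dif_pos h]
  exact Classical.choose_spec (s.exists_max_image f h)

/-! ### Payoff and regret -/

/-- A block of consecutive plays: the arms in `arms` are played one after the other, each play
taking place `gap` time units after the preceding one (for the first: after the end of the
preceding block, which is the time of the last play before it, or time `0`). -/
structure Block (K : ℕ) where
  gap : ℝ
  arms : List (Fin K)

/-- The end of the first `b` blocks. -/
def startTime {K : ℕ} (B : ℕ → Block K) (b : ℕ) : ℝ :=
  ∑ i ∈ Finset.range b, ((B i).arms.length : ℝ) * (B i).gap

/-- The payoff `∑ (μ_{k(t_i)} - 1 / Δt_i)` over all plays with `t_i ≤ T`. -/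
def payoff {K : ℕ} (μ : Fin K → ℝ) (T : ℝ) (B : ℕ → Block K) : ℝ :=
  ∑' b : ℕ, ∑ j : Fin (B b).arms.length,
    if startTime B b + ((j : ℝ) + 1) * (B b).gap ≤ T
      then μ ((B b).arms.get j) - 1 / (B b).gap else 0

/-- Only finitely many plays take place up to time `T`. -/
def FinitelyManyPlays {K : ℕ} (T : ℝ) (B : ℕ → Block K) : Prop :=
  {b : ℕ | (B b).arms ≠ [] ∧ startTime B b + (B b).gap ≤ T}.Finite

/-- The payoff of the oracle, which plays the best arm (mean `μ₁`) `N` times at equal intervals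
in `[0, T]`, for the best `N`. -/
def oraclePayoff (μ₁ T : ℝ) : ℝ := ⨆ N : ℕ, (μ₁ * N - (N : ℝ) ^ 2 / T)

/-! ### The algorithm LUCB1 for best-arm identification (accuracy `0`, confidence `1 - δ`) -/

/-- Width of the confidence interval in round `t` of an arm that was played `u` times. -/
def lucbWidth (K : ℕ) (δ : ℝ) (u t : ℕ) : ℝ :=
  Real.sqrt (Real.log (5 / 4 * (K : ℝ) * (t : ℝ) ^ 4 / δ) / (2 * (u : ℝ)))

/-- The arm with the highest empirical mean, if arm `a` was played `u a` times. -/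
def lucbHigh {K : ℕ} [NeZero K] (x : Rewards K) (u : Fin K → ℕ) : Fin K :=
  argmaxOn Finset.univ fun a => empMean x a (u a)

/-- Among the other arms, one with the highest upper confidence bound. -/
def lucbLow {K : ℕ} [NeZero K] (x : Rewards K) (δ : ℝ) (u : Fin K → ℕ) (t : ℕ) : Fin K :=
  argmaxOn (Finset.univ.erase (lucbHigh x u)) fun a => empMean x a (u a) + lucbWidth K δ (u a) t

/-- LUCB1 stops, and returns `lucbHigh`, when the upper confidence bound of `lucbLow` is below
the lower confidence bound of `lucbHigh`. -/
def LucbStop {K : ℕ} [NeZero K] (x : Rewards K) (δ : ℝ) (u : Fin K → ℕ) (t : ℕ) : Prop :=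
  empMean x (lucbLow x δ u t) (u (lucbLow x δ u t)) + lucbWidth K δ (u (lucbLow x δ u t)) t
    < empMean x (lucbHigh x u) (u (lucbHigh x u)) - lucbWidth K δ (u (lucbHigh x u)) t

/-- The arms that LUCB1 plays next: every arm once before round `1`, and two arms in
each round. -/
def lucbArms {K : ℕ} [NeZero K] (x : Rewards K) (δ : ℝ) (u : Fin K → ℕ) (t : ℕ) :
    List (Fin K) :=
  if t = 0 then List.finRange K else [lucbHigh x u, lucbLow x δ u t]

/-! ### The algorithm CTMAB -/

/-- The inputs of CTMAB; the phases of its exploit period have width `T ^ ν`. -/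
structure Params where
  T : ℝ
  ε : ℝ
  κ : ℝ
  δ : ℝ
  ν : ℝ

/-- Number of plays of each arm in phase `i ≥ 1` of the estimation period. -/
def Params.estCount (p : Params) (i : ℕ) : ℕ :=
  ⌈p.κ * Real.log p.T * p.T ^ ((2 / 3 : ℝ) * (i : ℝ) * p.ε)⌉₊

/-- Duration of phase `i ≥ 1` of the estimation period: it is the time interval
`[T ^ ((i - 1) ε), T ^ (i ε)]` for `i ≥ 2`, and `[0, T ^ ε]` for `i = 1`. -/
def Params.estLength (p : Params) (i : ℕ) : ℝ :=
  p.T ^ ((i : ℝ) * p.ε) - (p.T ^ (((i : ℝ) - 1) * p.ε) - if i = 1 then 1 else 0)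

/-- The estimation period ends when this holds, where `q` is the number of plays of each arm. -/
def EstStop {K : ℕ} (x : Rewards K) (δ : ℝ) (q : ℕ) : Prop :=
  ∃ k : Fin K, Real.sqrt (Real.log (2 / δ) / (q : ℝ)) < empMean x k q / 2

/-- The estimate of the largest mean after `q` plays of each arm. -/
def bestEstimate {K : ℕ} [NeZero K] (x : Rewards K) (q : ℕ) : ℝ :=
  empMean x (argmaxOn Finset.univ fun a => empMean x a q) q

/-- The state of CTMAB between two blocks of plays. -/
inductive State (K : ℕ) where
  /-- Estimation period, phase `i`: every arm was played `r` times in this phase and `q` times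
  altogether. -/
  | estimate (i r q : ℕ)
  /-- Identification period, after `q` plays of each arm in the estimation period: LUCB1 is in
  its round `t` (`t = 0`: before its first plays) and has played arm `a` `u a` times. -/
  | identify (q t : ℕ) (u : Fin K → ℕ)
  /-- Exploit period: arm `k`, which was played `n` times so far, was identified as the best. -/
  | exploit (k : Fin K) (n : ℕ)

/-- The next block of plays. In the estimation period, it is one play of every arm, the plays of
a phase being equally spaced in the phase. In the identification period, LUCB1 works with
one play per `1 / bestEstimate` time. In the exploit period, a block is a phase of width
`W = T ^ ν`: with `m` the empirical mean at its beginning, the arm is played `N = m * W / 2`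
times, at distance `W / N = 2 / m`; if `N` is not an integer, then it is rounded up, the distance
is kept, and the phase ends with its last play. -/
def nextBlock {K : ℕ} [NeZero K] (p : Params) (x : Rewards K) : State K → Block K
  | .estimate i _ _ => ⟨p.estLength i / ((K : ℝ) * (p.estCount i : ℝ)), List.finRange K⟩
  | .identify q t u => ⟨1 / bestEstimate x q, lucbArms (x.drop q) p.δ u t⟩
  | .exploit k n =>
      ⟨2 / empMean x k n, List.replicate ⌈empMean x k n * p.T ^ p.ν / 2⌉₊ k⟩

open Classical in
/-- The state after that block. -/
def nextState {K : ℕ} [NeZero K] (p : Params) (x : Rewards K) : State K → State K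
  | .estimate i r q =>
      if EstStop x p.δ (q + 1) then .identify (q + 1) 0 (fun _ => 0)
      else if p.estCount i ≤ r + 1 then .estimate (i + 1) 0 (q + 1)
      else .estimate i (r + 1) (q + 1)
  | .identify q t u =>
      let u' : Fin K → ℕ := fun a => u a + (lucbArms (x.drop q) p.δ u t).count a
      if LucbStop (x.drop q) p.δ u' (t + 1) then
        .exploit (lucbHigh (x.drop q) u') (q + u' (lucbHigh (x.drop q) u'))
      else .identify q (t + 1) u'
  | .exploit k n => .exploit k (n + ⌈empMean x k n * p.T ^ p.ν / 2⌉₊)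

/-- The state of CTMAB after `b` blocks. -/
def state {K : ℕ} [NeZero K] (p : Params) (x : Rewards K) : ℕ → State K
  | 0 => .estimate 1 0 0
  | b + 1 => nextState p x (state p x b)

/-- The blocks of plays of CTMAB. -/
def blocks {K : ℕ} [NeZero K] (p : Params) (x : Rewards K) (b : ℕ) : Block K :=
  nextBlock p x (state p x b)

/-- The leading term `max {μ₁ K log T / Δ², K² log² T / μ₁, log² T / μ₁}`. -/
def mainTerm (K : ℕ) (μ₁ Δ T : ℝ) : ℝ :=
  max (μ₁ * K / Δ ^ 2 * Real.log T)
    (max ((K : ℝ) ^ 2 / μ₁ * Real.log T ^ 2) (Real.log T ^ 2 / μ₁))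

end CTMAB

end

open MeasureTheory ProbabilityTheory

noncomputable section

set_option linter.unusedSectionVars false

namespace CTMAB

/-! ### Empirical means and the parameters of the estimation period -/

/-! Write m for the best mean, L for log T and z for the cube root of T^ε. The oracle earns at most
m²T/4, that is, m²/4 per unit of time. The proof bounds the amount by which the payoff of a run
falls behind this rate (`lag`), block by block, on a fixed table of rewards that is accurate enough
(`GoodRun`); probability enters only afterwards.

Estimation. Phase j+1 has about L z^(2j) plays per arm and length about z^(3j), so its sampling cost
is about K²L²z^j. These costs form a geometric sum dominated by the last phase. The stopping rule
fires once q is of order L/m², so the last z^j is at most 6/m (`pow_le_of_estStop`). The cost is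
then of order K²L²/m, and the time spent, of order 1/m³, is worth only 1/m to the oracle.

Identification. The estimate of m is correct up to a constant factor, so a play loses at most 2m
(`identify_gap`). LUCB1 needs O(K L/Δ²) rounds: a round that does not stop involves an arm whose
confidence interval is still wide (`exists_le_width_of_not_lucbStop`). The loss is of order mKL/Δ².

Exploitation. Playing at distance 2/e with an estimate e loses exactly (m-e)²/(2e) per play, which
is at most of order L/(nm) after n plays. Since a phase at most multiplies n by w+2, the sum behaves
like a harmonic sum and gives L²/m (`exploit_step`).

Inaccurate tables. The expectation uses three levels (`expected_regret_le`). Outside `badEvent` the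
bound above holds. On it, but outside the single event that the best arm is misjudged after Q plays,
the estimation cost is still bounded and the rest loses at most 2T. On that single event the cost
may reach order K²L²T, but its probability is at most 1/T². Hoeffding's inequality and union bounds
over deterministic ranges show that all contributions are of the order of the leading term. -/

lemma empMean_nonneg {K : ℕ} (x : Rewards K) (a : Fin K) (n : ℕ) : 0 ≤ empMean x a n := by
  unfold empMean
  refine div_nonneg (Finset.sum_nonneg fun j _ => ?_) (Nat.cast_nonneg n)
  split_ifs <;> norm_num

lemma empMean_le_one {K : ℕ} (x : Rewards K) (a : Fin K) (n : ℕ) : empMean x a n ≤ 1 := by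
  unfold empMean
  refine div_le_one_of_le₀ ?_ (Nat.cast_nonneg n)
  calc (∑ j ∈ Finset.range n, if x a j then (1 : ℝ) else 0)
      ≤ ∑ _j ∈ Finset.range n, (1 : ℝ) := by
        refine Finset.sum_le_sum fun j _ => ?_
        split_ifs <;> norm_num
    _ = n := by simp

/-- Parameters of CTMAB with `T ^ ε = z ^ 3`. -/
structure Params.Admissible (p : Params) (z : ℝ) : Prop where
  two_le : 2 ≤ p.T
  one_lt_kappa : 1 < p.κ
  one_lt : 1 < z
  rpow : p.T ^ p.ε = z ^ 3
  delta : p.δ = 1 / p.T ^ 2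

/-- The beginning of phase `j + 1` of the estimation period. -/
def phaseStart (z : ℝ) (j : ℕ) : ℝ := z ^ (3 * j) - if j = 0 then 1 else 0

/-- The factor in the bound for the sampling cost of one phase of the estimation period. -/
def phaseFactor (κ z : ℝ) : ℝ := (κ + 2) ^ 2 * z ^ 4 / (z ^ 3 - 1)

/-! ### Size, length and cost of the phases of the estimation period -/

namespace Params.Admissible

variable {p : Params} {z : ℝ} (h : p.Admissible z)

include h

lemma T_pos : 0 < p.T := by linarith [h.two_le]

lemma z_pos : 0 < z := by linarith [h.one_lt]

lemma log_lower : 0.69 ≤ Real.log p.T := by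
  have := Real.log_two_gt_d9
  have h2 : Real.log 2 ≤ Real.log p.T := Real.log_le_log (by norm_num) h.two_le
  linarith

lemma cube_sub_one_pos : 0 < z ^ 3 - 1 := by
  have := one_lt_pow₀ h.one_lt (n := 3) (by norm_num)
  linarith

lemma rpow_nat_mul (j : ℕ) : p.T ^ ((j : ℝ) * p.ε) = z ^ (3 * j) := by
  rw [mul_comm, Real.rpow_mul h.T_pos.le, h.rpow, Real.rpow_natCast, pow_mul]

lemma rpow_two_thirds (j : ℕ) : p.T ^ ((2 / 3 : ℝ) * (j : ℝ) * p.ε) = z ^ (2 * j) := by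
  have : (2 / 3 : ℝ) * (j : ℝ) * p.ε = p.ε * ((2 / 3 : ℝ) * j) := by ring
  rw [this, Real.rpow_mul h.T_pos.le, h.rpow, ← Real.rpow_natCast z 3, ← Real.rpow_mul h.z_pos.le,
    ← Real.rpow_natCast z (2 * j)]
  congr 1
  push_cast
  ring

lemma le_estCount (j : ℕ) : Real.log p.T * z ^ (2 * j) ≤ p.estCount j := by
  have hL := h.log_lower
  have hz : 0 < z ^ (2 * j) := pow_pos h.z_pos _
  have := Nat.le_ceil (p.κ * Real.log p.T * p.T ^ ((2 / 3 : ℝ) * (j : ℝ) * p.ε))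
  rw [h.rpow_two_thirds] at this
  unfold Params.estCount
  rw [h.rpow_two_thirds]
  nlinarith [h.one_lt_kappa, mul_pos (by linarith : (0:ℝ) < Real.log p.T) hz]

lemma estCount_pos (j : ℕ) : 0 < p.estCount j := by
  have := h.le_estCount j
  have hL := h.log_lower
  have hz : 0 < z ^ (2 * j) := pow_pos h.z_pos _
  have h3 : (0 : ℝ) < p.estCount j :=
    lt_of_lt_of_le (mul_pos (by linarith) hz) this
  exact_mod_cast h3

lemma estCount_le (j : ℕ) : (p.estCount j : ℝ) ≤ (p.κ + 2) * Real.log p.T * z ^ (2 * j) := by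
  have hL := h.log_lower
  have hz : 1 ≤ z ^ (2 * j) := one_le_pow₀ h.one_lt.le
  have h0 : 0 ≤ p.κ * Real.log p.T * z ^ (2 * j) := by
    have := h.one_lt_kappa
    positivity
  have := Nat.ceil_lt_add_one h0
  unfold Params.estCount
  rw [h.rpow_two_thirds]
  nlinarith [mul_le_mul hL hz (by norm_num) (by linarith)]

lemma estLength_succ (j : ℕ) :
    p.estLength (j + 1) = z ^ (3 * (j + 1)) - phaseStart z j := by
  unfold Params.estLength phaseStart
  have h1 : (((j + 1 : ℕ) : ℝ) - 1) * p.ε = (j : ℝ) * p.ε := by push_cast; ring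
  rw [h1, h.rpow_nat_mul, h.rpow_nat_mul]
  simp

lemma phaseStart_le (j : ℕ) : phaseStart z j ≤ z ^ (3 * j) := by
  unfold phaseStart
  split_ifs <;> linarith

lemma le_phaseStart (j : ℕ) : z ^ (3 * j) - 1 ≤ phaseStart z j := by
  unfold phaseStart
  split_ifs <;> linarith

lemma le_estLength (j : ℕ) : (z ^ 3 - 1) * z ^ (3 * j) ≤ p.estLength (j + 1) := by
  rw [h.estLength_succ]
  have := h.phaseStart_le j
  have h2 : z ^ (3 * (j + 1)) = z ^ 3 * z ^ (3 * j) := by ring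
  rw [h2]
  linarith

lemma estLength_pos (j : ℕ) : 0 < p.estLength (j + 1) :=
  lt_of_lt_of_le (mul_pos h.cube_sub_one_pos (pow_pos h.z_pos _)) (h.le_estLength j)

lemma phaseFactor_pos : 0 < phaseFactor p.κ z := by
  have := h.cube_sub_one_pos
  have := h.z_pos
  have := h.one_lt_kappa
  unfold phaseFactor
  positivity

/-- The squared number of plays grows like z^(4j) and the length like z^(3j). The exponent 2/3 in
the algorithm thus makes the cost grow like z^j, the square root of the growth of the number of
plays. -/
lemma phase_cost_le (K j : ℕ) :
    (K : ℝ) ^ 2 * (p.estCount (j + 1) : ℝ) ^ 2 / p.estLength (j + 1)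
      ≤ (K : ℝ) ^ 2 * Real.log p.T ^ 2 * phaseFactor p.κ z * z ^ j := by
  have hz := h.z_pos
  have hc := h.cube_sub_one_pos
  have h1 := h.estCount_le (j + 1)
  have h2 := h.le_estLength j
  have h3 := h.estLength_pos j
  rw [div_le_iff₀ h3]
  have h4 : (p.estCount (j + 1) : ℝ) ^ 2 ≤ ((p.κ + 2) * Real.log p.T * z ^ (2 * (j + 1))) ^ 2 :=
    pow_le_pow_left₀ (Nat.cast_nonneg _) h1 2
  have h5 : 0 ≤ (K : ℝ) ^ 2 * Real.log p.T ^ 2 * phaseFactor p.κ z * z ^ j := by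
    have := h.phaseFactor_pos
    positivity
  calc (K : ℝ) ^ 2 * (p.estCount (j + 1) : ℝ) ^ 2
      ≤ (K : ℝ) ^ 2 * ((p.κ + 2) * Real.log p.T * z ^ (2 * (j + 1))) ^ 2 := by gcongr
    _ = (K : ℝ) ^ 2 * Real.log p.T ^ 2 * phaseFactor p.κ z * z ^ j
          * ((z ^ 3 - 1) * z ^ (3 * j)) := by
        unfold phaseFactor
        field_simp
        ring
    _ ≤ _ := mul_le_mul_of_nonneg_left h2 h5

/-- The duration of a round grows at least like z^j up to constants. A bound that does not depend on
the phase is what limits the number of rounds before time T. -/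
lemma le_round_duration (j : ℕ) :
    (z ^ 3 - 1) / ((p.κ + 2) * Real.log p.T * z ^ 2)
      ≤ p.estLength (j + 1) / p.estCount (j + 1) := by
  have hz := h.z_pos
  have hc := h.cube_sub_one_pos
  have hL := h.log_lower
  have hk := h.one_lt_kappa
  have h1 := h.estCount_le (j + 1)
  have h2 := h.le_estLength j
  have h0 : (0 : ℝ) < p.estCount (j + 1) := by exact_mod_cast h.estCount_pos (j + 1)
  have hj : 1 ≤ z ^ j := one_le_pow₀ h.one_lt.le
  have hD : 0 < (p.κ + 2) * Real.log p.T * z ^ 2 := by positivity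
  rw [div_le_div_iff₀ hD h0]
  calc (z ^ 3 - 1) * (p.estCount (j + 1) : ℝ)
      ≤ (z ^ 3 - 1) * ((p.κ + 2) * Real.log p.T * z ^ (2 * (j + 1))) := by gcongr
    _ = (z ^ 3 - 1) * z ^ (2 * j) * 1 * ((p.κ + 2) * Real.log p.T * z ^ 2) := by ring
    _ ≤ (z ^ 3 - 1) * z ^ (2 * j) * z ^ j * ((p.κ + 2) * Real.log p.T * z ^ 2) := by gcongr
    _ = (z ^ 3 - 1) * z ^ (3 * j) * ((p.κ + 2) * Real.log p.T * z ^ 2) := by ring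
    _ ≤ _ := by gcongr

end Params.Admissible

/-! ### The run of the algorithm on a fixed table of rewards -/

lemma startTime_succ {K : ℕ} (B : ℕ → Block K) (b : ℕ) :
    startTime B (b + 1) = startTime B b + ((B b).arms.length : ℝ) * (B b).gap := by
  simp [startTime, Finset.sum_range_succ]

/-- The sampling cost of the first `b` blocks. -/
def samplingCost {K : ℕ} (B : ℕ → Block K) (b : ℕ) : ℝ :=
  ∑ i ∈ Finset.range b, ((B i).arms.length : ℝ) / (B i).gap

/-- The payoff up to time `T` of block `b`. -/
def blockPayoff {K : ℕ} (μ : Fin K → ℝ) (T : ℝ) (B : ℕ → Block K) (b : ℕ) : ℝ :=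
  ∑ j : Fin (B b).arms.length,
    if startTime B b + ((j : ℝ) + 1) * (B b).gap ≤ T
      then μ ((B b).arms.get j) - 1 / (B b).gap else 0

/-- The payoff up to time `T` of the first `b` blocks. -/
def partialPayoff {K : ℕ} (μ : Fin K → ℝ) (T : ℝ) (B : ℕ → Block K) (b : ℕ) : ℝ :=
  ∑ i ∈ Finset.range b, blockPayoff μ T B i

lemma partialPayoff_succ {K : ℕ} (μ : Fin K → ℝ) (T : ℝ) (B : ℕ → Block K) (b : ℕ) :
    partialPayoff μ T B (b + 1) = partialPayoff μ T B b + blockPayoff μ T B b := by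
  simp [partialPayoff, Finset.sum_range_succ]

section Run

variable {K : ℕ} [NeZero K] {p : Params} {z : ℝ} {x : Rewards K}

lemma state_succ (p : Params) (x : Rewards K) (b : ℕ) :
    state p x (b + 1) = nextState p x (state p x b) := rfl

lemma EstStop.bestEstimate_gt {δ : ℝ} {q : ℕ} (hs : EstStop x δ q) :
    Real.sqrt (Real.log (2 / δ) / (q : ℝ)) < bestEstimate x q / 2 := by
  obtain ⟨k, hk⟩ := hs
  have := (argmaxOn_spec Finset.univ (fun a => empMean x a q) ⟨k, Finset.mem_univ k⟩).2 k
    (Finset.mem_univ k)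
  unfold bestEstimate
  linarith

lemma EstStop.bestEstimate_pos {δ : ℝ} {q : ℕ} (hs : EstStop x δ q) : 0 < bestEstimate x q := by
  have := hs.bestEstimate_gt
  have := Real.sqrt_nonneg (Real.log (2 / δ) / (q : ℝ))
  linarith

lemma bestEstimate_le_one (x : Rewards K) (q : ℕ) : bestEstimate x q ≤ 1 :=
  empMean_le_one _ _ _

lemma blocks_estimate {b i r q : ℕ} (hs : state p x b = .estimate i r q) :
    blocks p x b = ⟨p.estLength i / ((K : ℝ) * (p.estCount i : ℝ)), List.finRange K⟩ := by
  simp [blocks, nextBlock, hs]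

lemma blocks_identify {b q t : ℕ} {u : Fin K → ℕ} (hs : state p x b = .identify q t u) :
    blocks p x b = ⟨1 / bestEstimate x q, lucbArms (x.drop q) p.δ u t⟩ := by
  simp [blocks, nextBlock, hs]

lemma blocks_exploit {b n : ℕ} {k : Fin K} (hs : state p x b = .exploit k n) :
    blocks p x b
      = ⟨2 / empMean x k n, List.replicate ⌈empMean x k n * p.T ^ p.ν / 2⌉₊ k⟩ := by
  simp [blocks, nextBlock, hs]

/-- What holds before block `b`, if CTMAB is then in phase `j + 1` of the estimation period. -/
structure EstimateInv (p : Params) (z : ℝ) (x : Rewards K) (b j r q : ℕ) : Prop where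
  index : b = q
  r_lt : r < p.estCount (j + 1)
  r_le : r ≤ q
  start : startTime (blocks p x) b
    = phaseStart z j + r * (p.estLength (j + 1) / p.estCount (j + 1))
  cost : samplingCost (blocks p x) b
    ≤ (K : ℝ) ^ 2 * Real.log p.T ^ 2 * phaseFactor p.κ z * (z ^ j / (z - 1))
      + r * ((K : ℝ) ^ 2 * p.estCount (j + 1) / p.estLength (j + 1))
  prev : j ≠ 0 → p.estCount j ≤ q
  not_ended : ∀ q', 1 ≤ q' → q' ≤ q → ¬ EstStop x p.δ q'

lemma state_estimate_inv (h : p.Admissible z) :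
    ∀ {b i r q : ℕ}, state p x b = .estimate i r q →
      ∃ j, i = j + 1 ∧ EstimateInv p z x b j r q := by
  intro b
  induction b with
  | zero =>
    intro i r q hs
    simp only [state, State.estimate.injEq] at hs
    obtain ⟨rfl, rfl, rfl⟩ := hs
    refine ⟨0, rfl, rfl, h.estCount_pos _, le_rfl, ?_, ?_, ?_, ?_⟩
    · simp [startTime, phaseStart]
    · have := h.phaseFactor_pos
      have hz : 0 < z - 1 := by linarith [h.one_lt]
      simp only [samplingCost, Finset.range_zero, Finset.sum_empty, Nat.cast_zero, zero_mul,
        add_zero]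
      positivity
    · intro h0
      exact absurd rfl h0
    · intro q' h1 h2
      omega
  | succ b ih =>
    intro i r q hs
    rw [state_succ] at hs
    rcases hb : state p x b with ⟨i', r', q'⟩ | ⟨q', t, u⟩ | ⟨k, n⟩
    · obtain ⟨j, rfl, inv⟩ := ih hb
      have hK : (K : ℝ) ≠ 0 := by exact_mod_cast NeZero.ne K
      have hN : (p.estCount (j + 1) : ℝ) ≠ 0 := by exact_mod_cast (h.estCount_pos (j + 1)).ne'
      have hl := (h.estLength_pos j).ne'
      have hstart : startTime (blocks p x) (b + 1)
          = phaseStart z j + (r' + 1) * (p.estLength (j + 1) / p.estCount (j + 1)) := by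
        rw [startTime_succ, inv.start, blocks_estimate hb]
        simp only [List.length_finRange]
        field_simp
        ring
      have hcost : samplingCost (blocks p x) (b + 1)
          ≤ (K : ℝ) ^ 2 * Real.log p.T ^ 2 * phaseFactor p.κ z * (z ^ j / (z - 1))
            + (r' + 1) * ((K : ℝ) ^ 2 * p.estCount (j + 1) / p.estLength (j + 1)) := by
        have : samplingCost (blocks p x) (b + 1) = samplingCost (blocks p x) b
            + (K : ℝ) ^ 2 * p.estCount (j + 1) / p.estLength (j + 1) := by
          rw [samplingCost, Finset.sum_range_succ, blocks_estimate hb]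
          simp only [List.length_finRange, samplingCost]
          field_simp
        rw [this]
        linarith [inv.cost]
      rw [hb] at hs
      unfold nextState at hs
      simp only at hs
      split_ifs at hs with h1 h2
      · simp only [State.estimate.injEq] at hs
        obtain ⟨rfl, rfl, rfl⟩ := hs
        have hr : p.estCount (j + 1) = r' + 1 := le_antisymm h2 inv.r_lt
        have hr' : ((r' : ℝ) + 1) = p.estCount (j + 1) := by rw [hr]; push_cast; ring
        refine ⟨j + 1, rfl, by rw [inv.index], h.estCount_pos _, by omega, ?_, ?_, ?_, ?_⟩
        · rw [hstart, hr', mul_div_cancel₀ _ hN, h.estLength_succ]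
          simp [phaseStart]
        · have hz : 0 < z - 1 := by linarith [h.one_lt]
          -- The earlier phases are charged z^j/(z-1) because this form reproduces itself: z^j/(z-1)
          -- + z^j = z^(j+1)/(z-1).
          have := h.phase_cost_le K j
          rw [hr'] at hcost
          calc _ ≤ _ := hcost
            _ = (K : ℝ) ^ 2 * Real.log p.T ^ 2 * phaseFactor p.κ z * (z ^ j / (z - 1))
                + (K : ℝ) ^ 2 * (p.estCount (j + 1) : ℝ) ^ 2 / p.estLength (j + 1) := by ring
            _ ≤ (K : ℝ) ^ 2 * Real.log p.T ^ 2 * phaseFactor p.κ z * (z ^ j / (z - 1))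
                + (K : ℝ) ^ 2 * Real.log p.T ^ 2 * phaseFactor p.κ z * z ^ j := by linarith
            _ = (K : ℝ) ^ 2 * Real.log p.T ^ 2 * phaseFactor p.κ z * (z ^ (j + 1) / (z - 1)) := by
                field_simp
                ring
            _ = _ := by simp
        · intro _
          have := inv.r_le
          omega
        · intro q'' h3 h4
          rcases Nat.lt_or_ge q'' (q' + 1) with h5 | h5
          · exact inv.not_ended q'' h3 (by omega)
          · obtain rfl : q'' = q' + 1 := by omega
            exact h1
      · simp only [State.estimate.injEq] at hs
        obtain ⟨rfl, rfl, rfl⟩ := hs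
        refine ⟨j, rfl, by rw [inv.index], by omega, by have := inv.r_le; omega, ?_, ?_, ?_, ?_⟩
        · rw [hstart]
          push_cast
          ring
        · push_cast
          exact hcost
        · intro hj
          have := inv.prev hj
          omega
        · intro q'' h3 h4
          rcases Nat.lt_or_ge q'' (q' + 1) with h5 | h5
          · exact inv.not_ended q'' h3 (by omega)
          · obtain rfl : q'' = q' + 1 := by omega
            exact h1
    · rw [hb] at hs
      unfold nextState at hs
      simp only at hs
      split_ifs at hs
    · rw [hb] at hs
      simp [nextState] at hs

/-- LUCB1 never changes q, so the condition that ended the estimation period stays available. It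
makes the best estimate positive, hence the distance of plays meaningful. -/
lemma state_identify_stop :
    ∀ {b q t : ℕ} {u : Fin K → ℕ}, state p x b = .identify q t u → EstStop x p.δ q := by
  intro b
  induction b with
  | zero => intro q t u hs; simp [state] at hs
  | succ b ih =>
    intro q t u hs
    rw [state_succ] at hs
    rcases hb : state p x b with ⟨i', r', q'⟩ | ⟨q', t', u'⟩ | ⟨k, n⟩ <;> rw [hb] at hs <;>
      unfold nextState at hs
    · simp only at hs
      split_ifs at hs with h1 h2
      simp only [State.identify.injEq] at hs
      obtain ⟨rfl, -, -⟩ := hs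
      exact h1
    · simp only at hs
      split_ifs at hs
      simp only [State.identify.injEq] at hs
      obtain ⟨rfl, -, -⟩ := hs
      exact ih hb
    · simp at hs

/-- A lower bound for the duration of the nonempty blocks. -/
def minDuration (p : Params) (z : ℝ) : ℝ :=
  min 1 ((z ^ 3 - 1) / ((p.κ + 2) * Real.log p.T * z ^ 2))

lemma Params.Admissible.minDuration_pos (h : p.Admissible z) : 0 < minDuration p z := by
  have := h.cube_sub_one_pos
  have := h.one_lt_kappa
  have := h.log_lower
  have := h.z_pos
  unfold minDuration
  positivity

/-- With empirical mean 0 the distance 2/0 is 0 by convention, but the phase then contains no play;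
nonempty blocks avoid this degenerate case. -/
lemma exploit_empMean_pos {b n : ℕ} {k : Fin K} (hs : state p x b = .exploit k n)
    (hne : (blocks p x b).arms ≠ []) : 0 < empMean x k n := by
  rcases (empMean_nonneg x k n).lt_or_eq with h0 | h0
  · exact h0
  · rw [blocks_exploit hs] at hne
    simp [← h0] at hne

lemma gap_pos (h : p.Admissible z) {b : ℕ} (hne : (blocks p x b).arms ≠ []) :
    0 < (blocks p x b).gap := by
  rcases hb : state p x b with ⟨i, r, q⟩ | ⟨q, t, u⟩ | ⟨k, n⟩
  · obtain ⟨j, rfl, -⟩ := state_estimate_inv h hb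
    rw [blocks_estimate hb]
    have hK : (0 : ℝ) < K := by exact_mod_cast NeZero.pos K
    have hN : (0 : ℝ) < p.estCount (j + 1) := by exact_mod_cast h.estCount_pos (j + 1)
    exact div_pos (h.estLength_pos j) (mul_pos hK hN)
  · rw [blocks_identify hb]
    have := (state_identify_stop hb).bestEstimate_pos
    positivity
  · have := exploit_empMean_pos hb hne
    rw [blocks_exploit hb]
    positivity

/-- Outside the estimation period, plays are at distance at least `1`. -/
lemma one_le_gap {b : ℕ} (hne : (blocks p x b).arms ≠ [])
    (hs : ∀ i r q, state p x b ≠ .estimate i r q) : 1 ≤ (blocks p x b).gap := by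
  rcases hb : state p x b with ⟨i, r, q⟩ | ⟨q, t, u⟩ | ⟨k, n⟩
  · exact absurd hb (hs i r q)
  · rw [blocks_identify hb]
    have h1 := (state_identify_stop hb).bestEstimate_pos
    rw [le_div_iff₀ h1]
    linarith [bestEstimate_le_one x q]
  · have h1 := exploit_empMean_pos hb hne
    rw [blocks_exploit hb]
    simp only
    rw [le_div_iff₀ h1]
    linarith [empMean_le_one x k n]

lemma minDuration_le (h : p.Admissible z) {b : ℕ} (hne : (blocks p x b).arms ≠ []) :
    minDuration p z ≤ ((blocks p x b).arms.length : ℝ) * (blocks p x b).gap := by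
  by_cases hs : ∃ i r q, state p x b = .estimate i r q
  · obtain ⟨i, r, q, hb⟩ := hs
    obtain ⟨j, rfl, -⟩ := state_estimate_inv h hb
    rw [blocks_estimate hb]
    have hK : (K : ℝ) ≠ 0 := by exact_mod_cast NeZero.ne K
    simp only [List.length_finRange]
    refine (min_le_right _ _).trans ((h.le_round_duration j).trans (le_of_eq ?_))
    field_simp
  · push Not at hs
    have h1 := one_le_gap hne hs
    have h2 : (1 : ℝ) ≤ (blocks p x b).arms.length := by
      exact_mod_cast List.length_pos_iff.2 hne
    refine (min_le_left _ _).trans ?_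
    nlinarith

lemma startTime_le_succ (h : p.Admissible z) (b : ℕ) :
    startTime (blocks p x) b ≤ startTime (blocks p x) (b + 1) := by
  rw [startTime_succ]
  by_cases hne : (blocks p x b).arms = []
  · simp [hne]
  · have := (minDuration_le h hne)
    have := h.minDuration_pos
    linarith

lemma startTime_mono (h : p.Admissible z) : Monotone (startTime (blocks p x)) :=
  monotone_nat_of_le_succ (startTime_le_succ h)

lemma startTime_nonneg (h : p.Admissible z) (b : ℕ) : 0 ≤ startTime (blocks p x) b := by
  have := startTime_mono (x := x) h (Nat.zero_le b)
  simpa [startTime] using this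

/-- An empty exploit phase leaves n unchanged, so the next one is empty as well, and blocks of the
other periods are never empty. The nonempty blocks therefore form an initial segment, each taking at
least `minDuration`. -/
lemma arms_ne_nil_of_succ (hK : 2 ≤ K) {b : ℕ} (hne : (blocks p x (b + 1)).arms ≠ []) :
    (blocks p x b).arms ≠ [] := by
  rcases hb : state p x b with ⟨i, r, q⟩ | ⟨q, t, u⟩ | ⟨k, n⟩
  · rw [blocks_estimate hb]
    simp only [ne_eq, List.finRange_eq_nil_iff]
    omega
  · rw [blocks_identify hb]
    simp only [lucbArms]
    split_ifs
    · simp only [ne_eq, List.finRange_eq_nil_iff]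
      omega
    · simp
  · intro h0
    apply hne
    have h1 : state p x (b + 1)
        = .exploit k (n + ⌈empMean x k n * p.T ^ p.ν / 2⌉₊) := by
      rw [state_succ, hb]; rfl
    rw [blocks_exploit hb] at h0
    simp only [List.replicate_eq_nil_iff] at h0
    rw [h0, add_zero] at h1
    rw [blocks_exploit h1]
    simp [h0]

lemma index_mul_le_startTime (h : p.Admissible z) :
    ∀ {b : ℕ}, (∀ i < b, (blocks p x i).arms ≠ []) →
      b * minDuration p z ≤ startTime (blocks p x) b := by
  intro b
  induction b with
  | zero => intro _; simp [startTime]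
  | succ b ih =>
    intro hne
    have h1 := ih fun i hi => hne i (by omega)
    have h2 := minDuration_le h (hne b (by omega))
    rw [startTime_succ]
    push_cast
    linarith

lemma arms_ne_nil_of_le (hK : 2 ≤ K) {b : ℕ} (hne : (blocks p x b).arms ≠ []) :
    ∀ i ≤ b, (blocks p x i).arms ≠ [] := by
  intro i hi
  induction b, hi using Nat.le_induction with
  | base => exact hne
  | succ b _ ih => exact ih (arms_ne_nil_of_succ hK hne)

/-- The number of blocks that may start before time `T`. -/
def blockBound (p : Params) (z : ℝ) : ℕ := ⌊p.T / minDuration p z⌋₊ + 1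

lemma T_lt_startTime (h : p.Admissible z) {b : ℕ} (hb : blockBound p z ≤ b)
    (hne : ∀ i < b, (blocks p x i).arms ≠ []) : p.T < startTime (blocks p x) b := by
  have h1 := index_mul_le_startTime h hne
  have h2 := h.minDuration_pos
  have h3 : p.T / minDuration p z < b := by
    have := Nat.lt_floor_add_one (p.T / minDuration p z)
    refine this.trans_le ?_
    have h4 : ((blockBound p z : ℕ) : ℝ) ≤ b := by exact_mod_cast hb
    unfold blockBound at h4
    push_cast at h4
    exact h4
  rw [div_lt_iff₀ h2] at h3
  linarith

lemma blockPayoff_eq_zero_of_lt (h : p.Admissible z) (μ : Fin K → ℝ) {b : ℕ}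
    (hb : p.T < startTime (blocks p x) b) : blockPayoff μ p.T (blocks p x) b = 0 := by
  unfold blockPayoff
  refine Finset.sum_eq_zero fun j _ => if_neg ?_
  have hne : (blocks p x b).arms ≠ [] := List.length_pos_iff.1 (Fin.pos j)
  have := gap_pos h hne
  have : 0 ≤ ((j : ℝ) + 1) * (blocks p x b).gap := by positivity
  linarith

/-- The truncation point is the same for all tables of rewards, which later yields measurability and
boundedness of the payoff. -/
lemma payoff_eq_partialPayoff (h : p.Admissible z) (hK : 2 ≤ K) (μ : Fin K → ℝ) :
    payoff μ p.T (blocks p x) = partialPayoff μ p.T (blocks p x) (blockBound p z) := by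
  unfold payoff partialPayoff
  refine tsum_eq_sum (f := blockPayoff μ p.T (blocks p x)) fun b hb => ?_
  rw [Finset.mem_range, not_lt] at hb
  by_cases hne : (blocks p x b).arms = []
  · unfold blockPayoff
    have : IsEmpty (Fin (blocks p x b).arms.length) := by
      rw [hne]; exact Fin.isEmpty
    simp
  · exact blockPayoff_eq_zero_of_lt h μ
      (T_lt_startTime h hb fun i hi => arms_ne_nil_of_le hK hne i hi.le)

lemma finitelyManyPlays (h : p.Admissible z) (hK : 2 ≤ K) :
    FinitelyManyPlays p.T (blocks p x) := by
  refine (Set.finite_lt_nat (blockBound p z)).subset ?_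
  rintro b ⟨hne, hb⟩
  by_contra hlt
  simp only [Set.mem_ofPred_eq, not_lt] at hlt
  have h1 := T_lt_startTime h hlt fun i hi => arms_ne_nil_of_le hK hne i hi.le
  have h2 := gap_pos h hne
  linarith

end Run

/-! ### Bounds for the payoff of a run -/

/-- An arm that is better by `Δ` than all others. -/
structure BestArm {K : ℕ} (μ : Fin K → ℝ) (k₀ : Fin K) (Δ : ℝ) : Prop where
  two_le : 2 ≤ K
  nonneg : ∀ a, 0 ≤ μ a
  lt_one : ∀ a, μ a < 1
  gap_pos : 0 < Δ
  gap_le : ∀ a, a ≠ k₀ → μ a + Δ ≤ μ k₀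

namespace BestArm

variable {K : ℕ} {μ : Fin K → ℝ} {k₀ : Fin K} {Δ : ℝ}

lemma gap_le_mean (hμ : BestArm μ k₀ Δ) : Δ ≤ μ k₀ := by
  have : Nontrivial (Fin K) := Fin.nontrivial_iff_two_le.2 hμ.two_le
  obtain ⟨a, ha⟩ := exists_ne k₀
  linarith [hμ.gap_le a ha, hμ.nonneg a]

lemma mean_pos (hμ : BestArm μ k₀ Δ) : 0 < μ k₀ := hμ.gap_pos.trans_le hμ.gap_le_mean

lemma le_mean (hμ : BestArm μ k₀ Δ) (a : Fin K) : μ a ≤ μ k₀ := by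
  rcases eq_or_ne a k₀ with rfl | ha
  · exact le_rfl
  · linarith [hμ.gap_le a ha, hμ.gap_pos]

end BestArm

lemma Params.Admissible.two_div_delta {p : Params} {z : ℝ} (h : p.Admissible z) :
    2 / p.δ = 2 * p.T ^ 2 := by
  rw [h.delta]
  have := h.T_pos
  field_simp

lemma Params.Admissible.log_two_div_delta {p : Params} {z : ℝ} (h : p.Admissible z) :
    Real.log (2 / p.δ) = Real.log 2 + 2 * Real.log p.T := by
  have := h.T_pos
  rw [h.two_div_delta, Real.log_mul (by norm_num) (by positivity), Real.log_pow]
  norm_num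

lemma Params.Admissible.log_two_div_delta_le {p : Params} {z : ℝ} (h : p.Admissible z) :
    Real.log (2 / p.δ) ≤ 3 * Real.log p.T := by
  have := Real.log_le_log (by norm_num) h.two_le
  rw [h.log_two_div_delta]
  linarith

lemma Params.Admissible.one_lt_log_two_div_delta {p : Params} {z : ℝ} (h : p.Admissible z) :
    1 < Real.log (2 / p.δ) := by
  have := Real.log_two_gt_d9
  have := h.log_lower
  rw [h.log_two_div_delta]
  linarith

/-- Telescoping: if every play earns at least the increase of a potential φ of time minus ρ, so does
the block with ρ counted once per play. Plays after T earn 0, so for them the increase must be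
absorbed by ρ. -/
lemma le_blockPayoff {K : ℕ} (μ : Fin K → ℝ) (T : ℝ) (B : ℕ → Block K) (b : ℕ) (φ : ℝ → ℝ) (ρ : ℝ)
    (hφ : ∀ s, s + (B b).gap ≤ T → ∀ k ∈ (B b).arms,
      φ (s + (B b).gap) - φ s - ρ ≤ μ k - 1 / (B b).gap)
    (hφ' : ∀ s, T < s + (B b).gap → φ (s + (B b).gap) - φ s - ρ ≤ 0) :
    φ (startTime B (b + 1)) - φ (startTime B b) - (B b).arms.length * ρ ≤ blockPayoff μ T B b := by
  set g := (B b).gap with hg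
  set n := (B b).arms.length with hn
  have h1 : φ (startTime B (b + 1)) - φ (startTime B b) - n * ρ
      = ∑ j : Fin n, (φ (startTime B b + ((j : ℝ) + 1) * g) - φ (startTime B b + (j : ℝ) * g) - ρ) := by
    rw [Finset.sum_sub_distrib, Finset.sum_const, Finset.card_univ, Fintype.card_fin, nsmul_eq_mul,
      Fin.sum_univ_eq_sum_range
        (fun j => φ (startTime B b + ((j : ℝ) + 1) * g) - φ (startTime B b + (j : ℝ) * g)) n]
    have := Finset.sum_range_sub (fun j : ℕ => φ (startTime B b + (j : ℝ) * g)) n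
    push_cast at this
    rw [this, startTime_succ]
    simp [hg, hn]
  rw [h1]
  refine Finset.sum_le_sum fun j _ => ?_
  have h2 : startTime B b + ((j : ℝ) + 1) * g = startTime B b + (j : ℝ) * g + g := by ring
  rw [h2]
  split_ifs with h3
  · exact hφ _ h3 _ (List.get_mem _ _)
  · exact hφ' _ (not_le.1 h3)

/-! ### Crude payoff bounds, and the length of the estimation period -/

section Run

variable {K : ℕ} [NeZero K] {p : Params} {z : ℝ} {x : Rewards K} {μ : Fin K → ℝ}

lemma neg_cost_le_blockPayoff (h : p.Admissible z) (hμ : ∀ a, 0 ≤ μ a) (b : ℕ) :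
    -(((blocks p x b).arms.length : ℝ) / (blocks p x b).gap)
      ≤ blockPayoff μ p.T (blocks p x) b := by
  by_cases hne : (blocks p x b).arms = []
  · have h1 : blockPayoff μ p.T (blocks p x) b = 0 := by
      unfold blockPayoff
      have : IsEmpty (Fin (blocks p x b).arms.length) := by
        rw [hne]; exact Fin.isEmpty
      simp
    rw [h1, hne]
    simp
  · have hg := gap_pos h hne
    have := le_blockPayoff μ p.T (blocks p x) b (fun _ => 0) (1 / (blocks p x b).gap)
      (fun s _ k _ => by simpa using hμ k) (fun s _ => by simpa using hg.le)
    simp only [sub_self, zero_sub] at this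
    rwa [mul_one_div] at this

lemma neg_samplingCost_le (h : p.Admissible z) (hμ : ∀ a, 0 ≤ μ a) (b : ℕ) :
    -samplingCost (blocks p x) b ≤ partialPayoff μ p.T (blocks p x) b := by
  unfold samplingCost partialPayoff
  rw [← Finset.sum_neg_distrib]
  exact Finset.sum_le_sum fun i _ => neg_cost_le_blockPayoff h hμ i

lemma EstimateInv.samplingCost_succ_le (h : p.Admissible z) {b j r q : ℕ}
    (hb : state p x b = .estimate (j + 1) r q) (inv : EstimateInv p z x b j r q) :
    samplingCost (blocks p x) (b + 1)
      ≤ (K : ℝ) ^ 2 * Real.log p.T ^ 2 * (phaseFactor p.κ z * (z / (z - 1)) * z ^ j) := by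
  have hK : (K : ℝ) ≠ 0 := by exact_mod_cast NeZero.ne K
  have hN : (p.estCount (j + 1) : ℝ) ≠ 0 := by exact_mod_cast (h.estCount_pos (j + 1)).ne'
  have hl := h.estLength_pos j
  have hz : 0 < z - 1 := by linarith [h.one_lt]
  have h1 : samplingCost (blocks p x) (b + 1) = samplingCost (blocks p x) b
      + (K : ℝ) ^ 2 * p.estCount (j + 1) / p.estLength (j + 1) := by
    rw [samplingCost, Finset.sum_range_succ, blocks_estimate hb]
    simp only [List.length_finRange, samplingCost]
    field_simp
  have h2 : ((r : ℝ) + 1) ≤ p.estCount (j + 1) := by exact_mod_cast inv.r_lt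
  have h3 : ((r : ℝ) + 1) * ((K : ℝ) ^ 2 * p.estCount (j + 1) / p.estLength (j + 1))
      ≤ p.estCount (j + 1) * ((K : ℝ) ^ 2 * p.estCount (j + 1) / p.estLength (j + 1)) := by
    gcongr
  have h4 := h.phase_cost_le K j
  have h5 := inv.cost
  have h6 : (p.estCount (j + 1) : ℝ) * ((K : ℝ) ^ 2 * p.estCount (j + 1) / p.estLength (j + 1))
    = (K : ℝ) ^ 2 * (p.estCount (j + 1) : ℝ) ^ 2 / p.estLength (j + 1) := by ring
  have h7 : (K : ℝ) ^ 2 * Real.log p.T ^ 2 * (phaseFactor p.κ z * (z / (z - 1)) * z ^ j)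
      = (K : ℝ) ^ 2 * Real.log p.T ^ 2 * phaseFactor p.κ z * (z ^ j / (z - 1))
        + (K : ℝ) ^ 2 * Real.log p.T ^ 2 * phaseFactor p.κ z * z ^ j := by
    field_simp
    ring
  rw [h1, h7]
  linarith

lemma EstimateInv.startTime_succ_le (h : p.Admissible z) {b j r q : ℕ}
    (hb : state p x b = .estimate (j + 1) r q) (inv : EstimateInv p z x b j r q) :
    startTime (blocks p x) (b + 1) ≤ z ^ (3 * (j + 1)) := by
  have hK : (K : ℝ) ≠ 0 := by exact_mod_cast NeZero.ne K
  have hN : (p.estCount (j + 1) : ℝ) ≠ 0 := by exact_mod_cast (h.estCount_pos (j + 1)).ne'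
  have hl := h.estLength_pos j
  have h1 : startTime (blocks p x) (b + 1)
      = phaseStart z j + (r + 1) * (p.estLength (j + 1) / p.estCount (j + 1)) := by
    rw [startTime_succ, inv.start, blocks_estimate hb]
    simp only [List.length_finRange]
    field_simp
    ring
  have h2 : ((r : ℝ) + 1) ≤ p.estCount (j + 1) := by exact_mod_cast inv.r_lt
  have h3 : ((r : ℝ) + 1) * (p.estLength (j + 1) / p.estCount (j + 1))
      ≤ p.estCount (j + 1) * (p.estLength (j + 1) / p.estCount (j + 1)) := by
    gcongr
  rw [mul_div_cancel₀ _ hN] at h3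
  have h4 := h.estLength_succ j
  linarith

/-- A lower bound for the payoff that uses only how long the estimation period lasts. -/
lemma le_partialPayoff (h : p.Admissible z) (hμ : ∀ a, 0 ≤ μ a) {Z : ℝ} (hZ0 : 0 ≤ Z)
    (hZ : ∀ b j r q, state p x b = .estimate (j + 1) r q → startTime (blocks p x) b ≤ p.T →
      z ^ j ≤ Z) (b : ℕ) :
    -((K : ℝ) ^ 2 * Real.log p.T ^ 2 * (phaseFactor p.κ z * (z / (z - 1)) * Z))
        - min (startTime (blocks p x) b) p.T
      ≤ partialPayoff μ p.T (blocks p x) b := by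
  have hz : 0 < z - 1 := by linarith [h.one_lt]
  have hz0 := h.z_pos
  have hE := h.phaseFactor_pos
  have hT := h.T_pos
  have hA : 0 ≤ (K : ℝ) ^ 2 * Real.log p.T ^ 2 * (phaseFactor p.κ z * (z / (z - 1)) * Z) := by
    positivity
  induction b with
  | zero => simpa [partialPayoff, startTime, hT.le] using hA
  | succ b ih =>
    have hmono := startTime_le_succ (x := x) h b
    rcases lt_or_ge p.T (startTime (blocks p x) b) with hb | hb
    · rw [partialPayoff_succ, blockPayoff_eq_zero_of_lt h μ hb, add_zero]
      rw [min_eq_right hb.le] at ih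
      rwa [min_eq_right (hb.le.trans hmono)]
    by_cases hs : ∃ i r q, state p x b = .estimate i r q
    · obtain ⟨i, r, q, hs⟩ := hs
      obtain ⟨j, rfl, inv⟩ := state_estimate_inv h hs
      -- The induction hypothesis is not needed here: the sampling cost of all blocks so far is
      -- bounded at once, and rewards are ignored.
      have h1 := inv.samplingCost_succ_le h hs
      have h2 := neg_samplingCost_le (x := x) h hμ (b + 1)
      have h3 : (K : ℝ) ^ 2 * Real.log p.T ^ 2 * (phaseFactor p.κ z * (z / (z - 1)) * z ^ j)
          ≤ (K : ℝ) ^ 2 * Real.log p.T ^ 2 * (phaseFactor p.κ z * (z / (z - 1)) * Z) := by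
        have := hZ b j r q hs hb
        gcongr
      have h4 : 0 ≤ min (startTime (blocks p x) (b + 1)) p.T :=
        le_min (startTime_nonneg h _) hT.le
      linarith
    · push Not at hs
      by_cases hne : (blocks p x b).arms = []
      · have h1 := neg_cost_le_blockPayoff (x := x) h hμ b
        rw [startTime_succ, partialPayoff_succ]
        rw [hne] at h1 ⊢
        simp only [List.length_nil, Nat.cast_zero, zero_div, neg_zero, zero_mul, add_zero] at h1 ⊢
        linarith
      · have hg := one_le_gap hne hs
        have h1 := le_blockPayoff μ p.T (blocks p x) b (fun s => -min s p.T) 0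
          (fun s hsT k _ => by
            have : 1 / (blocks p x b).gap ≤ 1 := by
              rw [div_le_one (by linarith)]
              exact hg
            have h2 := hμ k
            rw [min_eq_left hsT, min_eq_left (by linarith)]
            linarith)
          (fun s _ => by
            have : min s p.T ≤ min (s + (blocks p x b).gap) p.T :=
              min_le_min_right _ (by linarith)
            linarith)
        rw [partialPayoff_succ]
        linarith

/-- No accuracy is needed: phase j+1 begins no earlier than z^(3j)-1. This serves tables on which
the stopping rule may fire late. -/
lemma pow_le_of_startTime_le (h : p.Admissible z) {b j r q : ℕ}
    (hb : state p x b = .estimate (j + 1) r q) (hT : startTime (blocks p x) b ≤ p.T) :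
    z ^ j ≤ 2 * p.T := by
  obtain ⟨j', hj, inv⟩ := state_estimate_inv h hb
  obtain rfl : j = j' := by omega
  have h1 := inv.start
  have h2 := h.le_phaseStart j
  have h3 : 0 ≤ (r : ℝ) * (p.estLength (j + 1) / p.estCount (j + 1)) := by
    have := h.estLength_pos j
    positivity
  have h4 : z ^ j ≤ z ^ (3 * j) := pow_le_pow_right₀ h.one_lt.le (by omega)
  have := h.two_le
  linarith

variable {k₀ : Fin K} {Δ : ℝ} {Q : ℕ}

lemma sqrt_le_of_mul_sq {l m : ℝ} {n : ℕ} {s : ℝ} (hm : 0 ≤ m) (hs : 0 < s) (hn : 0 < n)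
    (hl : s ^ 2 * l ≤ n * m ^ 2) : Real.sqrt (l / n) ≤ m / s := by
  have hn' : (0 : ℝ) < n := by exact_mod_cast hn
  rw [Real.sqrt_le_left (by positivity), div_pow, div_le_div_iff₀ hn' (by positivity)]
  linarith

/-- With r the square root in the stopping rule, the choice of Q gives r ≤ m/3, while the empirical
mean exceeds m - 3r/4. The rule asks for 2r to be below this mean, and 11r/4 ≤ 11m/12 < m. -/
lemma estStop_of_accurate (h : p.Admissible z) (hμ : BestArm μ k₀ Δ)
    (hQ : 9 * Real.log (2 / p.δ) ≤ Q * μ k₀ ^ 2)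
    (hx : |empMean x k₀ Q - μ k₀| < 3 / 4 * Real.sqrt (Real.log (2 / p.δ) / Q)) :
    EstStop x p.δ Q := by
  refine ⟨k₀, ?_⟩
  have hl := h.one_lt_log_two_div_delta
  have hQ0 : 0 < Q := by
    rcases Nat.eq_zero_or_pos Q with rfl | h0
    · simp only [Nat.cast_zero, zero_mul] at hQ
      linarith
    · exact h0
  have h1 := sqrt_le_of_mul_sq (s := 3) (l := Real.log (2 / p.δ)) hμ.mean_pos.le (by norm_num) hQ0 (by linarith)
  have h2 := Real.sqrt_nonneg (Real.log (2 / p.δ) / Q)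
  have h3 := abs_lt.1 hx
  linarith

lemma EstimateInv.lt_of_estStop {b j r q : ℕ} (inv : EstimateInv p z x b j r q)
    (hQ0 : 1 ≤ Q) (hQ : EstStop x p.δ Q) : q < Q := by
  by_contra hlt
  exact inv.not_ended Q hQ0 (not_lt.1 hlt) hQ

/-- The preceding phase was completed without stopping, so its L z^(2j) plays per arm number at most
Q ≤ 29 L/m². The constant 6 comes from 29 ≤ 36; phase 1 has no predecessor and is trivial. -/
lemma pow_le_of_estStop (h : p.Admissible z) (hμ : BestArm μ k₀ Δ)
    (hQ0 : 1 ≤ Q) (hQ' : (Q : ℝ) ≤ 29 * Real.log p.T / μ k₀ ^ 2) (hQ : EstStop x p.δ Q)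
    {b j r q : ℕ} (hb : state p x b = .estimate (j + 1) r q) :
    z ^ j ≤ 6 / μ k₀ := by
  obtain ⟨j', hj, inv⟩ := state_estimate_inv h hb
  obtain rfl : j = j' := by omega
  have hm := hμ.mean_pos
  have hm1 := hμ.lt_one k₀
  rcases eq_or_ne j 0 with rfl | hj0
  · rw [pow_zero, le_div_iff₀ hm]
    linarith
  have h1 : (p.estCount j : ℝ) ≤ Q := by
    have := inv.prev hj0
    have := inv.lt_of_estStop hQ0 hQ
    exact_mod_cast (by omega : p.estCount j ≤ Q)
  have hL := h.log_lower
  have h2 := h.le_estCount j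
  have h3 : Real.log p.T * z ^ (2 * j) ≤ Real.log p.T * (29 / μ k₀ ^ 2) := by
    calc _ ≤ _ := (h2.trans h1).trans hQ'
      _ = _ := by ring
  have h4 : z ^ (2 * j) ≤ 29 / μ k₀ ^ 2 := le_of_mul_le_mul_left h3 (by linarith)
  refine le_of_sq_le_sq ?_ (by positivity)
  calc (z ^ j) ^ 2 = z ^ (2 * j) := by ring
    _ ≤ 29 / μ k₀ ^ 2 := h4
    _ ≤ 36 / μ k₀ ^ 2 := by gcongr; norm_num
    _ = (6 / μ k₀) ^ 2 := by ring

end Run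

/-! ### LUCB1 on accurate rewards -/

/-- An arm has at most t plays in round t, so accuracy with the width of round u for u plays covers
all rounds in which the arm has u plays. The union bound then runs over u only. -/
lemma lucbWidth_mono (K : ℕ) {δ : ℝ} (hδ : 0 < δ) (hK : 1 ≤ K) (u : ℕ) {s t : ℕ}
    (hs : 1 ≤ s) (hst : s ≤ t) : lucbWidth K δ u s ≤ lucbWidth K δ u t := by
  unfold lucbWidth
  have hK' : (0 : ℝ) < K := by exact_mod_cast hK
  have hs' : (0 : ℝ) < s := by exact_mod_cast hs
  gcongr

lemma lucbWidth_nonneg (K : ℕ) (δ : ℝ) (u t : ℕ) : 0 ≤ lucbWidth K δ u t := Real.sqrt_nonneg _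

/-- All empirical means of `y` up to `M` plays lie in their confidence intervals. -/
def LucbAccurate {K : ℕ} (y : Rewards K) (μ : Fin K → ℝ) (δ : ℝ) (M : ℕ) : Prop :=
  ∀ a u, 1 ≤ u → u ≤ M → |empMean y a u - μ a| ≤ lucbWidth K δ u u

section

variable {K : ℕ} [NeZero K] {y : Rewards K} {μ : Fin K → ℝ} {δ Δ : ℝ} {k₀ : Fin K}

lemma lucbHigh_spec (y : Rewards K) (u : Fin K → ℕ) (a : Fin K) :
    empMean y a (u a) ≤ empMean y (lucbHigh y u) (u (lucbHigh y u)) :=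
  (argmaxOn_spec Finset.univ (fun a => empMean y a (u a)) ⟨a, Finset.mem_univ a⟩).2 a
    (Finset.mem_univ a)

lemma lucbLow_spec (hK : 2 ≤ K) (y : Rewards K) (δ : ℝ) (u : Fin K → ℕ) (t : ℕ) :
    lucbLow y δ u t ≠ lucbHigh y u ∧ ∀ a, a ≠ lucbHigh y u →
      empMean y a (u a) + lucbWidth K δ (u a) t
        ≤ empMean y (lucbLow y δ u t) (u (lucbLow y δ u t))
          + lucbWidth K δ (u (lucbLow y δ u t)) t := by
  have : Nontrivial (Fin K) := Fin.nontrivial_iff_two_le.2 hK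
  obtain ⟨a, ha⟩ := exists_ne (lucbHigh y u)
  have h1 := argmaxOn_spec (Finset.univ.erase (lucbHigh y u))
    (fun a => empMean y a (u a) + lucbWidth K δ (u a) t) ⟨a, by simpa using ha⟩
  refine ⟨?_, fun a ha => h1.2 a (by simpa using ha)⟩
  have := h1.1
  simp only [Finset.mem_erase, Finset.mem_univ, and_true] at this
  exact this

variable {u : Fin K → ℕ} {t : ℕ}

/-- If h were another arm, the upper bound of l would be at least that of the best arm, hence at
least the best mean, which exceeds the mean of h and so its lower bound: the rule could not stop. -/
lemma LucbStop.lucbHigh_eq (hμ : BestArm μ k₀ Δ)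
    (hy : ∀ a, |empMean y a (u a) - μ a| ≤ lucbWidth K δ (u a) t) (hs : LucbStop y δ u t) :
    lucbHigh y u = k₀ := by
  by_contra hne
  have h1 := (lucbLow_spec hμ.two_le y δ u t).2 k₀ (Ne.symm hne)
  have h2 := hμ.gap_le _ hne
  have h3 := abs_le.1 (hy k₀)
  have h4 := abs_le.1 (hy (lucbHigh y u))
  have h5 := hμ.gap_pos
  unfold LucbStop at hs
  linarith

/-- Suppose both widths are below Δ/4. If h is the best arm, failure to stop gives Δ ≤ 2β_h + 2β_l.
If l is the best arm, the choice of h gives Δ ≤ β_h + β_l. If neither is, the choice of l gives Δ ≤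
2β_l. Each is a contradiction. -/
lemma exists_le_width_of_not_lucbStop (hμ : BestArm μ k₀ Δ)
    (hy : ∀ a, |empMean y a (u a) - μ a| ≤ lucbWidth K δ (u a) t) (hs : ¬ LucbStop y δ u t) :
    ∃ a, (a = lucbHigh y u ∨ a = lucbLow y δ u t) ∧ Δ / 4 ≤ lucbWidth K δ (u a) t := by
  by_contra hcon
  push Not at hcon
  have hh := hcon _ (Or.inl rfl)
  have hl := hcon _ (Or.inr rfl)
  obtain ⟨hne, hmax⟩ := lucbLow_spec hμ.two_le y δ u t
  have hmaxh := lucbHigh_spec y u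
  unfold LucbStop at hs
  have h1 := abs_le.1 (hy (lucbHigh y u))
  have h2 := abs_le.1 (hy (lucbLow y δ u t))
  have h3 := hμ.gap_pos
  by_cases hk : lucbHigh y u = k₀
  · have h4 := hμ.gap_le (lucbLow y δ u t) (by rw [← hk]; exact hne)
    have h5 := congrArg μ hk
    linarith
  · have h4 := hμ.gap_le _ hk
    by_cases hk' : lucbLow y δ u t = k₀
    · have h5 := hmaxh (lucbLow y δ u t)
      have h6 := congrArg μ hk'
      linarith
    · have h5 := hμ.gap_le _ hk'
      have h6 := hmax k₀ (Ne.symm hk)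
      have h7 := abs_le.1 (hy k₀)
      linarith

/-- Squaring Δ/4 ≤ √(Λ/(2n)) gives n ≤ 8Λ/Δ². -/
lemma lt_of_le_lucbWidth (hΔ : 0 < Δ) {Λ : ℝ} {n : ℕ} (hn : 1 ≤ n)
    (hΛ : Real.log (5 / 4 * (K : ℝ) * (t : ℝ) ^ 4 / δ) ≤ Λ)
    (hw : Δ / 4 ≤ lucbWidth K δ n t) : n < ⌊8 * Λ / Δ ^ 2⌋₊ + 1 := by
  have hn' : (0 : ℝ) < n := by exact_mod_cast hn
  unfold lucbWidth at hw
  rw [Real.le_sqrt' (by positivity), le_div_iff₀ (by positivity)] at hw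
  rw [Nat.lt_succ_iff]
  refine Nat.le_floor ?_
  rw [le_div_iff₀ (by positivity)]
  linarith

lemma count_lucbArms_zero (y : Rewards K) (δ : ℝ) (u : Fin K → ℕ) (a : Fin K) :
    (lucbArms y δ u 0).count a = 1 := by
  simp only [lucbArms, if_true]
  exact List.count_eq_one_of_mem (List.nodup_finRange K) (List.mem_finRange a)

lemma count_lucbArms_le_one (hK : 2 ≤ K) (y : Rewards K) (δ : ℝ) (u : Fin K → ℕ) (t : ℕ)
    (a : Fin K) : (lucbArms y δ u t).count a ≤ 1 := by
  rcases Nat.eq_zero_or_pos t with rfl | ht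
  · rw [count_lucbArms_zero]
  · rw [lucbArms, if_neg ht.ne']
    refine List.nodup_iff_count_le_one.1 ?_ a
    simpa using (lucbLow_spec hK y δ u t).1.symm

lemma count_lucbArms_pos (ht : t ≠ 0) {a : Fin K}
    (ha : a = lucbHigh y u ∨ a = lucbLow y δ u t) : 1 ≤ (lucbArms y δ u t).count a := by
  rw [lucbArms, if_neg ht, Nat.one_le_iff_ne_zero, ← Nat.pos_iff_ne_zero, List.count_pos_iff]
  simpa using ha

/-- The counts of LUCB1, truncated at `U`, increase in every round before which an arm with
fewer than `U` plays is chosen. -/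
lemma lt_sum_min_count {U : ℕ} (ht : t ≠ 0) {a : Fin K}
    (ha : a = lucbHigh y u ∨ a = lucbLow y δ u t) (hU : u a < U) :
    ∑ b, min (u b) U < ∑ b, min (u b + (lucbArms y δ u t).count b) U := by
  refine Finset.sum_lt_sum (fun b _ => by omega) ⟨a, Finset.mem_univ a, ?_⟩
  have := count_lucbArms_pos ht ha
  omega

end

/-! ### The run on accurate rewards -/

/-- The reward table `x` is accurate enough for CTMAB to behave as intended: the estimation period
ends within `Q` rounds, and no arm is played more than `M` times. -/
structure GoodRun {K : ℕ} (p : Params) (z : ℝ) (x : Rewards K) (μ : Fin K → ℝ) (k₀ : Fin K)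
    (Δ w : ℝ) (Q M : ℕ) : Prop where
  adm : p.Admissible z
  best : BestArm μ k₀ Δ
  w_pos : 0 < w
  width_le : p.T ^ p.ν ≤ w / μ k₀ ^ 3
  le_Q : 9 * Real.log (2 / p.δ) ≤ Q * μ k₀ ^ 2
  Q_le : (Q : ℝ) ≤ 29 * Real.log p.T / μ k₀ ^ 2
  le_M : Q + p.T ≤ M
  K_le : (K : ℝ) ≤ p.T
  accurate : ∀ a n, 1 ≤ n → n ≤ M →
    |empMean x a n - μ a| < 3 / 4 * Real.sqrt (Real.log (2 / p.δ) / n)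
  lucb : ∀ q ≤ Q, LucbAccurate (x.drop q) μ p.δ M

/-- An upper bound for the distance of plays on accurate rewards. -/
def gapBound (z m : ℝ) : ℝ := (216 * z ^ 3 + 6) / m ^ 3

/-- A bound for the regret of the estimation period. -/
def estimateRegret (K : ℕ) (p : Params) (z m : ℝ) : ℝ :=
  m ^ 2 / 4 * (z ^ 3 * (6 / m) ^ 3)
    + (K : ℝ) ^ 2 * Real.log p.T ^ 2 * (phaseFactor p.κ z * (z / (z - 1)) * (6 / m))

/-- A bound for the number of plays of one arm before LUCB1 knows it well enough. -/
def lucbCount (T Δ : ℝ) : ℕ := ⌊8 * (8 * Real.log T) / Δ ^ 2⌋₊ + 1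

/-- A bound for the regret of the estimation and identification periods. -/
def identifyRegret (K : ℕ) (p : Params) (z m Δ : ℝ) : ℝ :=
  estimateRegret K p z m + 2 * m * (K + 2 * (K * lucbCount p.T Δ + 1))

/-- The growth rate of the regret in the exploit period, on the logarithmic scale. -/
def exploitRate (p : Params) (w m : ℝ) : ℝ := (w + 2) * (Real.log (2 / p.δ) / m)

/-- A bound for the regret on accurate rewards, up to the last gap. -/
def runRegret (K : ℕ) (p : Params) (z m Δ w : ℝ) (M : ℕ) : ℝ :=
  identifyRegret K p z m Δ + exploitRate p w m * Real.log ((w + 2) * M)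

/-- The excess of the oracle payoff over the payoff of the first `b` blocks. -/
def lag {K : ℕ} [NeZero K] (p : Params) (z : ℝ) (x : Rewards K) (μ : Fin K → ℝ) (m : ℝ) (b : ℕ) :
    ℝ :=
  m ^ 2 / 4 * min (startTime (blocks p x) b) (p.T - gapBound z m)
    - partialPayoff μ p.T (blocks p x) b

/-- What holds in the identification period on accurate rewards. -/
structure IdentifyInv {K : ℕ} [NeZero K] (p : Params) (z : ℝ) (x : Rewards K) (μ : Fin K → ℝ)
    (k₀ : Fin K) (Δ : ℝ) (Q b q t : ℕ) (u : Fin K → ℕ) : Prop where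
  one_le : 1 ≤ q
  q_le : q ≤ Q
  t_le : (t : ℝ) ≤ startTime (blocks p x) b
  zero : t = 0 → ∀ a, u a = 0
  u_pos : t ≠ 0 → ∀ a, 1 ≤ u a
  u_le : ∀ a, u a ≤ t
  not_ended : t ≠ 0 → ¬ LucbStop (x.drop q) p.δ u t
  t_le_sum : t ≤ ∑ a, min (u a) (lucbCount p.T Δ)
  lag_le : lag p z x μ (μ k₀) b
    ≤ estimateRegret K p z (μ k₀) + 2 * μ k₀ * (if t = 0 then 0 else K + 2 * t)

/-- What holds in the exploit period on accurate rewards. -/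
structure ExploitInv {K : ℕ} [NeZero K] (p : Params) (z : ℝ) (x : Rewards K) (μ : Fin K → ℝ)
    (k₀ : Fin K) (Δ w : ℝ) (Q b : ℕ) (k : Fin K) (n : ℕ) : Prop where
  arm : k = k₀
  one_le : 1 ≤ n
  n_le : (n : ℝ) ≤ Q + startTime (blocks p x) b
  le_n : 3 / 2 * Real.log (2 / p.δ) ≤ n * μ k₀ ^ 2
  lag_le : lag p z x μ (μ k₀) b
    ≤ identifyRegret K p z (μ k₀) Δ + exploitRate p w (μ k₀) * Real.log n

/-! ### Accuracy of the estimates, and the lag per block -/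

namespace GoodRun

variable {K : ℕ} [NeZero K] {p : Params} {z : ℝ} {x : Rewards K} {μ : Fin K → ℝ} {k₀ : Fin K}
  {Δ w : ℝ} {Q M : ℕ} (g : GoodRun p z x μ k₀ Δ w Q M)

include g

lemma one_le_Q : 1 ≤ Q := by
  rcases Nat.eq_zero_or_pos Q with rfl | h0
  · have := g.le_Q
    have := g.adm.one_lt_log_two_div_delta
    simp only [Nat.cast_zero, zero_mul] at *
    linarith
  · exact h0

lemma Q_le_M : Q ≤ M := by
  have := g.le_M
  have := g.adm.T_pos
  exact_mod_cast (by linarith : (Q : ℝ) ≤ M)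

lemma T_le_M : p.T ≤ M := by
  have := g.le_M
  have : (0 : ℝ) ≤ Q := Nat.cast_nonneg _
  linarith

lemma estStop : EstStop x p.δ Q :=
  estStop_of_accurate g.adm g.best g.le_Q (g.accurate k₀ Q g.one_le_Q g.Q_le_M)

lemma pow_le {b j r q : ℕ} (hb : state p x b = .estimate (j + 1) r q) : z ^ j ≤ 6 / μ k₀ :=
  pow_le_of_estStop g.adm g.best g.one_le_Q g.Q_le g.estStop hb

lemma phase_end_le {b j r q : ℕ} (hb : state p x b = .estimate (j + 1) r q) :
    z ^ (3 * (j + 1)) ≤ z ^ 3 * (6 / μ k₀) ^ 3 := by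
  have hz := g.adm.z_pos
  calc z ^ (3 * (j + 1)) = z ^ 3 * (z ^ j) ^ 3 := by ring
    _ ≤ _ := by
      have := g.pow_le hb
      gcongr

lemma estimateRegret_nonneg : 0 ≤ estimateRegret K p z (μ k₀) := by
  have := g.best.mean_pos
  have := g.adm.z_pos
  have := g.adm.phaseFactor_pos
  have : 0 < z - 1 := by linarith [g.adm.one_lt]
  unfold estimateRegret
  positivity

/-- All rewards of the period are given up: the oracle's income until the end of the last phase and
the whole sampling cost are charged. -/
lemma estimate_lag_le {b i r q : ℕ} (hb : state p x b = .estimate i r q) :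
    lag p z x μ (μ k₀) (b + 1) ≤ estimateRegret K p z (μ k₀) := by
  obtain ⟨j, rfl, inv⟩ := state_estimate_inv g.adm hb
  have h1 := inv.samplingCost_succ_le g.adm hb
  have h2 := neg_samplingCost_le (x := x) g.adm g.best.nonneg (b + 1)
  have h3 := (inv.startTime_succ_le g.adm hb).trans (g.phase_end_le hb)
  have h4 := min_le_left (startTime (blocks p x) (b + 1)) (p.T - gapBound z (μ k₀))
  have hE := g.adm.phaseFactor_pos
  have hz0 := g.adm.z_pos
  have hz : 0 < z - 1 := by linarith [g.adm.one_lt]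
  have h5 : (K : ℝ) ^ 2 * Real.log p.T ^ 2 * (phaseFactor p.κ z * (z / (z - 1)) * z ^ j)
      ≤ (K : ℝ) ^ 2 * Real.log p.T ^ 2 * (phaseFactor p.κ z * (z / (z - 1)) * (6 / μ k₀)) := by
    have := g.pow_le hb
    gcongr
  have h6 : μ k₀ ^ 2 / 4 * min (startTime (blocks p x) (b + 1)) (p.T - gapBound z (μ k₀))
      ≤ μ k₀ ^ 2 / 4 * (z ^ 3 * (6 / μ k₀) ^ 3) := by
    gcongr
    exact h4.trans h3
  unfold lag estimateRegret
  linarith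

/-- The potential is the oracle's income up to time min(s, T-G), where G bounds the distance of
plays. A play that falls after T starts its waiting time after T-G, so the potential no longer grows
and the discarded play costs nothing. -/
lemma lag_succ_le {b : ℕ} {ρ : ℝ} (hρ : 0 ≤ ρ) (hg0 : 0 ≤ (blocks p x b).gap)
    (hg : (blocks p x b).gap ≤ gapBound z (μ k₀))
    (hk : ∀ k ∈ (blocks p x b).arms,
      μ k₀ ^ 2 / 4 * (blocks p x b).gap - ρ ≤ μ k - 1 / (blocks p x b).gap) :
    lag p z x μ (μ k₀) (b + 1)
      ≤ lag p z x μ (μ k₀) b + (blocks p x b).arms.length * ρ := by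
  set G := gapBound z (μ k₀) with hG
  have h1 := le_blockPayoff μ p.T (blocks p x) b (fun s => μ k₀ ^ 2 / 4 * min s (p.T - G)) ρ
    (fun s _ k hkm => by
      have h2 : min (s + (blocks p x b).gap) (p.T - G) ≤ min s (p.T - G) + (blocks p x b).gap := by
        rw [← min_add_add_right]
        exact min_le_min_left _ (by linarith)
      have h3 := hk k hkm
      have h4 : μ k₀ ^ 2 / 4 * min (s + (blocks p x b).gap) (p.T - G)
          ≤ μ k₀ ^ 2 / 4 * (min s (p.T - G) + (blocks p x b).gap) := by gcongr
      linarith)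
    (fun s hs => by
      rw [min_eq_right (by linarith : p.T - G ≤ s + (blocks p x b).gap),
        min_eq_right (by linarith : p.T - G ≤ s)]
      linarith)
  unfold lag
  rw [partialPayoff_succ]
  linarith

/-- Let e be the estimate and r the square root in the rule, so r < e/2. The error is below 3r/4 <
3e/8, so e - 3e/8 is below some mean and e + 3e/8 is above the best one. Then r ≤ 4m/5, which bounds
q from below. -/
lemma bestEstimate_bounds {q : ℕ} (hq1 : 1 ≤ q) (hqM : q ≤ M) (hs : EstStop x p.δ q) :
    bestEstimate x q ≤ 8 / 5 * μ k₀ ∧ 8 / 11 * μ k₀ ≤ bestEstimate x q ∧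
      3 / 2 * Real.log (2 / p.δ) ≤ q * μ k₀ ^ 2 := by
  have h1 := hs.bestEstimate_gt
  set k := argmaxOn Finset.univ fun a => empMean x a q with hk
  have h2 : empMean x k₀ q ≤ bestEstimate x q :=
    (argmaxOn_spec Finset.univ (fun a => empMean x a q) ⟨k₀, Finset.mem_univ k₀⟩).2 k₀
      (Finset.mem_univ k₀)
  have h3 := abs_lt.1 (g.accurate k₀ q hq1 hqM)
  have h4 : bestEstimate x q - μ k < _ := (abs_lt.1 (g.accurate k q hq1 hqM)).2
  have h5 := g.best.le_mean k
  have h6 : bestEstimate x q ≤ 8 / 5 * μ k₀ := by linarith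
  refine ⟨h6, by linarith, ?_⟩
  have h7 : Real.sqrt (Real.log (2 / p.δ) / q) ≤ 4 / 5 * μ k₀ := by linarith
  have hq : (0 : ℝ) < q := by exact_mod_cast hq1
  have hm := g.best.mean_pos
  rw [Real.sqrt_le_left (by positivity), div_le_iff₀ hq] at h7
  have : 0 < q * μ k₀ ^ 2 := by positivity
  linarith

/-- The lower bound on n gives r ≤ 8m/9 for the square root r, so the error is at most 2m/3. -/
lemma exploit_bounds {n : ℕ} (hn1 : 1 ≤ n) (hnM : n ≤ M)
    (hn : 3 / 2 * Real.log (2 / p.δ) ≤ n * μ k₀ ^ 2) :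
    μ k₀ / 3 ≤ empMean x k₀ n ∧ empMean x k₀ n ≤ 2 * μ k₀ ∧
      (μ k₀ - empMean x k₀ n) ^ 2 ≤ 9 / 16 * (Real.log (2 / p.δ) / n) := by
  have hl := g.adm.one_lt_log_two_div_delta
  have hm := g.best.mean_pos
  have hn0 : (0 : ℝ) < n := by exact_mod_cast hn1
  have h1 := abs_lt.1 (g.accurate k₀ n hn1 hnM)
  have h0 : 0 ≤ Real.log (2 / p.δ) / n := by positivity
  set r := Real.sqrt (Real.log (2 / p.δ) / n) with hr
  have hr0 : 0 ≤ r := Real.sqrt_nonneg _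
  have h2 : r ^ 2 = Real.log (2 / p.δ) / n := Real.sq_sqrt h0
  have h3 : r ≤ 8 / 9 * μ k₀ := by
    refine le_of_sq_le_sq ?_ (by positivity)
    rw [h2, div_le_iff₀ hn0]
    have : 0 < n * μ k₀ ^ 2 := by positivity
    linarith
  refine ⟨by linarith, by linarith, ?_⟩
  rw [← h2]
  nlinarith

/-- The width condition gives N ≤ (w+1)/m² ≤ (w+1)n, so the loss of the phase, of order N/n, is
comparable to N/(n+N) ≤ log((n+N)/n). These logarithms telescope over the phases. -/
lemma exploit_step {n : ℕ} (hn1 : 1 ≤ n) (hnM : n ≤ M)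
    (hn : 3 / 2 * Real.log (2 / p.δ) ≤ n * μ k₀ ^ 2) :
    let N := ⌈empMean x k₀ n * p.T ^ p.ν / 2⌉₊
    (N : ℝ) * ((μ k₀ - empMean x k₀ n) ^ 2 / (2 * empMean x k₀ n))
        ≤ exploitRate p w (μ k₀) * (Real.log ((n + N : ℕ) : ℝ) - Real.log n) ∧
      ((n + N : ℕ) : ℝ) ≤ (w + 2) * n := by
  intro N
  obtain ⟨h1, h2, h3⟩ := g.exploit_bounds hn1 hnM hn
  have hl := g.adm.one_lt_log_two_div_delta
  have hm := g.best.mean_pos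
  have hm1 := g.best.lt_one k₀
  have hw := g.w_pos
  have hn0 : (0 : ℝ) < n := by exact_mod_cast hn1
  have hTν : 0 < p.T ^ p.ν := Real.rpow_pos_of_pos g.adm.T_pos _
  set m := empMean x k₀ n with hmdef
  have hm0 : 0 < m := by linarith
  set l := Real.log (2 / p.δ) with hldef
  have hN : (N : ℝ) ≤ (w + 1) / μ k₀ ^ 2 := by
    have h4 : (N : ℝ) < m * p.T ^ p.ν / 2 + 1 := Nat.ceil_lt_add_one (by positivity)
    have h5 : m * p.T ^ p.ν / 2 ≤ 2 * μ k₀ * (w / μ k₀ ^ 3) / 2 := by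
      have := g.width_le
      gcongr
    have h6 : 2 * μ k₀ * (w / μ k₀ ^ 3) / 2 = w / μ k₀ ^ 2 := by field_simp
    have h7 : 1 ≤ 1 / μ k₀ ^ 2 := by
      rw [le_div_iff₀ (by positivity)]
      nlinarith
    rw [add_div]
    linarith
  have hNn : (N : ℝ) ≤ (w + 1) * n := by
    have h4 : 1 / μ k₀ ^ 2 ≤ n := by
      rw [div_le_iff₀ (by positivity)]
      linarith
    calc (N : ℝ) ≤ (w + 1) * (1 / μ k₀ ^ 2) := by rw [mul_one_div]; exact hN
      _ ≤ (w + 1) * n := by gcongr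
  have hNn' : ((n + N : ℕ) : ℝ) ≤ (w + 2) * n := by
    push_cast
    linarith
  refine ⟨?_, hNn'⟩
  have hnN : (0 : ℝ) < ((n + N : ℕ) : ℝ) := by
    push_cast
    positivity
  have hlog : N / ((w + 2) * n) ≤ Real.log ((n + N : ℕ) : ℝ) - Real.log n := by
    rw [← Real.log_div hnN.ne' hn0.ne']
    have h4 := Real.one_sub_inv_le_log_of_pos (div_pos hnN hn0)
    refine le_trans ?_ h4
    rw [inv_div]
    calc (N : ℝ) / ((w + 2) * n) ≤ N / ((n + N : ℕ) : ℝ) := by gcongr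
      _ = 1 - n / ((n + N : ℕ) : ℝ) := by
        rw [eq_sub_iff_add_eq, ← add_div, div_eq_one_iff_eq hnN.ne']
        push_cast
        ring
  have hρ : (μ k₀ - m) ^ 2 / (2 * m) ≤ l / n / μ k₀ := by
    rw [div_le_div_iff₀ (by positivity) hm]
    have h0 : 0 ≤ l / n := by positivity
    nlinarith
  calc (N : ℝ) * ((μ k₀ - m) ^ 2 / (2 * m)) ≤ N * (l / n / μ k₀) := by gcongr
    _ = exploitRate p w (μ k₀) * (N / ((w + 2) * n)) := by
      unfold exploitRate
      rw [← hldef]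
      field_simp
    _ ≤ _ := by
      have : 0 ≤ exploitRate p w (μ k₀) := by unfold exploitRate; positivity
      gcongr

lemma exploitRate_nonneg : 0 ≤ exploitRate p w (μ k₀) := by
  have hl := g.adm.one_lt_log_two_div_delta
  have hm := g.best.mean_pos
  have hw := g.w_pos
  unfold exploitRate
  positivity

lemma identifyRegret_le_runRegret (hM : 1 ≤ M) :
    identifyRegret K p z (μ k₀) Δ ≤ runRegret K p z (μ k₀) Δ w M := by
  have h1 := g.exploitRate_nonneg
  have hM' : (1 : ℝ) ≤ M := by exact_mod_cast hM
  have h2 : 0 ≤ Real.log ((w + 2) * M) := Real.log_nonneg (by nlinarith [g.w_pos])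
  unfold runRegret
  have := mul_nonneg h1 h2
  linarith

/-- The eighth power splits as T for 5/4, T for K, T⁴ for t⁴ and T² for 1/δ. -/
lemma log_width_le {t : ℕ} (ht : t ≠ 0) (htT : (t : ℝ) ≤ p.T) :
    Real.log (5 / 4 * (K : ℝ) * (t : ℝ) ^ 4 / p.δ) ≤ 8 * Real.log p.T := by
  have hK : (0 : ℝ) < K := by exact_mod_cast NeZero.pos K
  have ht' : (0 : ℝ) < t := by exact_mod_cast Nat.pos_of_ne_zero ht
  have hT := g.adm.T_pos
  have h2 := g.adm.two_le
  have h1 : (8 : ℝ) * Real.log p.T = Real.log (p.T ^ 8) := by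
    rw [Real.log_pow]
    norm_num
  rw [h1, g.adm.delta]
  refine Real.log_le_log (by positivity) ?_
  rw [div_div_eq_mul_div, div_one]
  calc 5 / 4 * (K : ℝ) * (t : ℝ) ^ 4 * p.T ^ 2 ≤ p.T * p.T * p.T ^ 4 * p.T ^ 2 := by
        have := g.K_le
        have : (5 / 4 : ℝ) ≤ p.T := by linarith
        gcongr
    _ = p.T ^ 8 := by ring

end GoodRun

/-! ### Invariants through identification and exploitation -/

namespace GoodRun

variable {K : ℕ} [NeZero K] {p : Params} {z : ℝ} {x : Rewards K} {μ : Fin K → ℝ} {k₀ : Fin K}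
  {Δ w : ℝ} {Q M : ℕ} (g : GoodRun p z x μ k₀ Δ w Q M)

include g

lemma le_gapBound {y : ℝ} (hy : y ≤ 6 / μ k₀) : y ≤ gapBound z (μ k₀) := by
  have hm := g.best.mean_pos
  have hm1 := g.best.lt_one k₀
  have hz := g.adm.z_pos
  refine hy.trans ?_
  unfold gapBound
  rw [div_le_div_iff₀ hm (by positivity)]
  have h1 : μ k₀ ^ 2 ≤ 1 := by nlinarith
  have h2 : 0 < z ^ 3 * μ k₀ := by positivity
  nlinarith

lemma identify_init {b i r q q' t : ℕ} {u : Fin K → ℕ} (hb : state p x b = .estimate i r q)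
    (hb' : state p x (b + 1) = .identify q' t u) :
    IdentifyInv p z x μ k₀ Δ Q (b + 1) q' t u := by
  obtain ⟨j, rfl, inv⟩ := state_estimate_inv g.adm hb
  have hq := inv.lt_of_estStop g.one_le_Q g.estStop
  have hlag := g.estimate_lag_le hb
  rw [state_succ, hb] at hb'
  unfold nextState at hb'
  simp only at hb'
  split_ifs at hb'
  simp only [State.identify.injEq] at hb'
  obtain ⟨rfl, rfl, rfl⟩ := hb'
  exact {
    one_le := by omega
    q_le := by omega
    t_le := by simpa using startTime_nonneg g.adm (b + 1)
    zero := fun _ _ => rfl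
    u_pos := fun h0 => absurd rfl h0
    u_le := fun _ => le_rfl
    not_ended := fun h0 => absurd rfl h0
    t_le_sum := Nat.zero_le _
    lag_le := by simpa using hlag }

/-- Even with reward 0, a play loses at most the oracle's income during one distance, 11m/32, plus
the cost e ≤ 8m/5; the sum is below 2m. -/
lemma identify_gap {b q t : ℕ} {u : Fin K → ℕ} (hb : state p x b = .identify q t u)
    (inv : IdentifyInv p z x μ k₀ Δ Q b q t u) :
    0 ≤ (blocks p x b).gap ∧ (blocks p x b).gap ≤ gapBound z (μ k₀) ∧
      ∀ k, μ k₀ ^ 2 / 4 * (blocks p x b).gap - 2 * μ k₀ ≤ μ k - 1 / (blocks p x b).gap := by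
  have hm := g.best.mean_pos
  obtain ⟨h1, h2, -⟩ := g.bestEstimate_bounds inv.one_le (inv.q_le.trans g.Q_le_M)
    (state_identify_stop hb)
  have h0 := (state_identify_stop hb).bestEstimate_pos
  rw [blocks_identify hb]
  simp only [one_div_one_div]
  set e := bestEstimate x q
  have h3 : 1 / e ≤ 11 / 8 / μ k₀ := by
    rw [div_le_div_iff₀ h0 hm]
    linarith
  refine ⟨by positivity, g.le_gapBound (h3.trans (by gcongr; norm_num)), fun k => ?_⟩
  have h4 : μ k₀ ^ 2 / 4 * (1 / e) ≤ μ k₀ ^ 2 / 4 * (11 / 8 / μ k₀) := by gcongr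
  have h5 : μ k₀ ^ 2 / 4 * (11 / 8 / μ k₀) = 11 / 32 * μ k₀ := by
    field_simp
    norm_num
  have := g.best.nonneg k
  linarith

lemma identify_lag_succ {b q t : ℕ} {u : Fin K → ℕ} (hb : state p x b = .identify q t u)
    (inv : IdentifyInv p z x μ k₀ Δ Q b q t u) :
    lag p z x μ (μ k₀) (b + 1)
      ≤ estimateRegret K p z (μ k₀) + 2 * μ k₀ * (K + 2 * t) + if t = 0 then 0 else 4 * μ k₀ := by
  have hm := g.best.mean_pos
  obtain ⟨h0, h1, h2⟩ := g.identify_gap hb inv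
  have h3 := g.lag_succ_le (ρ := 2 * μ k₀) (by linarith) h0 h1 fun k _ => h2 k
  have h4 := inv.lag_le
  have h5 : (blocks p x b).arms = lucbArms (x.drop q) p.δ u t := by rw [blocks_identify hb]
  rw [h5] at h3
  unfold lucbArms at h3
  split_ifs at h3 h4 ⊢ with ht
  · subst ht
    simp only [List.length_finRange] at h3
    push_cast at h4 ⊢
    linarith
  · simp only [List.length_cons, List.length_nil] at h3
    push_cast at h3 h4
    linarith

lemma identify_startTime {b q t : ℕ} {u : Fin K → ℕ} (hb : state p x b = .identify q t u)
    (inv : IdentifyInv p z x μ k₀ Δ Q b q t u) :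
    (blocks p x b).arms ≠ [] ∧
      ((t + 1 : ℕ) : ℝ) ≤ startTime (blocks p x) (b + 1) := by
  have h1 : (blocks p x b).arms = lucbArms (x.drop q) p.δ u t := by rw [blocks_identify hb]
  have hne : (blocks p x b).arms ≠ [] := by
    rw [h1]
    unfold lucbArms
    have := g.best.two_le
    split_ifs
    · simp only [ne_eq, List.finRange_eq_nil_iff]
      omega
    · simp
  refine ⟨hne, ?_⟩
  have h2 := one_le_gap hne (by simp [hb])
  have h3 : (1 : ℝ) ≤ (blocks p x b).arms.length := by
    exact_mod_cast List.length_pos_iff.2 hne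
  have h4 := inv.t_le
  rw [startTime_succ]
  push_cast
  nlinarith

lemma t_le {b q t : ℕ} {u : Fin K → ℕ}
    (inv : IdentifyInv p z x μ k₀ Δ Q b q t u) : t ≤ K * lucbCount p.T Δ := by
  refine inv.t_le_sum.trans ?_
  calc ∑ a, min (u a) (lucbCount p.T Δ) ≤ ∑ _a : Fin K, lucbCount p.T Δ :=
        Finset.sum_le_sum fun a _ => min_le_right _ _
    _ = _ := by simp

lemma identify_lag_succ_le {b q t : ℕ} {u : Fin K → ℕ} (hb : state p x b = .identify q t u)
    (inv : IdentifyInv p z x μ k₀ Δ Q b q t u) :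
    lag p z x μ (μ k₀) (b + 1) ≤ identifyRegret K p z (μ k₀) Δ := by
  have hm := g.best.mean_pos
  have h1 := g.identify_lag_succ hb inv
  have h2 : (t : ℝ) ≤ K * lucbCount p.T Δ := by exact_mod_cast g.t_le inv
  have h3 : (if t = 0 then 0 else 4 * μ k₀) ≤ 4 * μ k₀ := by
    split_ifs <;> linarith
  have h4 : 2 * μ k₀ * (K + 2 * t) ≤ 2 * μ k₀ * (K + 2 * (K * lucbCount p.T Δ)) := by gcongr
  unfold identifyRegret
  linarith

lemma lucb_accurate {y : Rewards K} (hy : LucbAccurate y μ p.δ M) {t : ℕ} {u : Fin K → ℕ}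
    (htT : (t : ℝ) ≤ p.T) (hu1 : ∀ a, 1 ≤ u a) (hut : ∀ a, u a ≤ t) (a : Fin K) :
    |empMean y a (u a) - μ a| ≤ lucbWidth K p.δ (u a) t := by
  have htM : t ≤ M := by exact_mod_cast htT.trans g.T_le_M
  have hδ : 0 < p.δ := by
    rw [g.adm.delta]
    have := g.adm.T_pos
    positivity
  exact (hy a (u a) (hu1 a) ((hut a).trans htM)).trans
    (lucbWidth_mono K hδ (NeZero.one_le) _ (hu1 a) (hut a))

/-- The number of plays of each arm after the next plays of LUCB1. -/
lemma next_count {q t b : ℕ} {u : Fin K → ℕ}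
    (inv : IdentifyInv p z x μ k₀ Δ Q b q t u) (a : Fin K) :
    1 ≤ u a + (lucbArms (x.drop q) p.δ u t).count a ∧
      u a + (lucbArms (x.drop q) p.δ u t).count a ≤ t + 1 := by
  have h1 := count_lucbArms_le_one g.best.two_le (x.drop q) p.δ u t a
  have h2 := inv.u_le a
  refine ⟨?_, by omega⟩
  rcases eq_or_ne t 0 with rfl | ht
  · rw [count_lucbArms_zero]
    omega
  · have := inv.u_pos ht a
    omega

lemma identify_step {b q t q' t' : ℕ} {u u' : Fin K → ℕ} (hb : state p x b = .identify q t u)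
    (inv : IdentifyInv p z x μ k₀ Δ Q b q t u) (hT : startTime (blocks p x) (b + 1) ≤ p.T)
    (hb' : state p x (b + 1) = .identify q' t' u') :
    IdentifyInv p z x μ k₀ Δ Q (b + 1) q' t' u' := by
  have hm := g.best.mean_pos
  have hlag := g.identify_lag_succ hb inv
  obtain ⟨-, hS⟩ := g.identify_startTime hb inv
  have htT : (t : ℝ) ≤ p.T := by
    push_cast at hS
    linarith
  rw [state_succ, hb] at hb'
  unfold nextState at hb'
  simp only at hb'
  split_ifs at hb' with hend
  simp only [State.identify.injEq] at hb'
  obtain ⟨rfl, rfl, rfl⟩ := hb'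
  refine ⟨inv.one_le, inv.q_le, hS, fun h0 => absurd h0 (by omega),
    fun _ a => (g.next_count inv a).1, fun a => (g.next_count inv a).2, fun _ => hend, ?_, ?_⟩
  · rcases eq_or_ne t 0 with rfl | ht
    -- The opening plays raise the truncated sum from 0 to K ≥ 1; the `+ 1` in `lucbCount` ensures
    -- that the truncation does not remove them.
    · have h1 : ∀ a, min (u a + (lucbArms (x.drop q) p.δ u 0).count a) (lucbCount p.T Δ) = 1 := by
        intro a
        rw [count_lucbArms_zero, inv.zero rfl a]
        unfold lucbCount
        omega
      simp only [h1]
      simpa using NeZero.one_le (n := K)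
    -- Since LUCB1 did not stop, one of the two arms played has a wide interval, hence fewer than
    -- `lucbCount` plays. The truncated sum grows by at least 1, which bounds the number of rounds
    -- by K times `lucbCount`.
    · obtain ⟨a, ha, haw⟩ := exists_le_width_of_not_lucbStop g.best
        (g.lucb_accurate (g.lucb q inv.q_le) htT (inv.u_pos ht) inv.u_le) (inv.not_ended ht)
      have h1 := lt_of_le_lucbWidth g.best.gap_pos (inv.u_pos ht a) (g.log_width_le ht htT) haw
      have h2 := lt_sum_min_count (δ := p.δ) ht ha h1
      have h3 := inv.t_le_sum
      unfold lucbCount at h3 ⊢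
      omega
  · refine hlag.trans ?_
    rw [if_neg (Nat.succ_ne_zero t)]
    push_cast
    split_ifs with ht
    · subst ht
      push_cast
      linarith
    · linarith

lemma exploit_init {b q t n : ℕ} {u : Fin K → ℕ} {k : Fin K} (hb : state p x b = .identify q t u)
    (inv : IdentifyInv p z x μ k₀ Δ Q b q t u) (hT : startTime (blocks p x) (b + 1) ≤ p.T)
    (hb' : state p x (b + 1) = .exploit k n) :
    ExploitInv p z x μ k₀ Δ w Q (b + 1) k n := by
  have hlag := g.identify_lag_succ_le hb inv
  obtain ⟨-, hS⟩ := g.identify_startTime hb inv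
  obtain ⟨-, -, hq⟩ := g.bestEstimate_bounds inv.one_le (inv.q_le.trans g.Q_le_M)
    (state_identify_stop hb)
  have hm := g.best.mean_pos
  rw [state_succ, hb] at hb'
  unfold nextState at hb'
  simp only at hb'
  split_ifs at hb' with hend
  simp only [State.exploit.injEq] at hb'
  obtain ⟨hk, hn⟩ := hb'
  have hk0 := hend.lucbHigh_eq g.best (g.lucb_accurate (g.lucb q inv.q_le) (hS.trans hT)
    (fun a => (g.next_count inv a).1) fun a => (g.next_count inv a).2)
  have hu := g.next_count inv (lucbHigh (x.drop q) fun a =>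
    u a + (lucbArms (x.drop q) p.δ u t).count a)
  have hn1 : q ≤ n ∧ n ≤ q + (t + 1) := by omega
  have hq1 := inv.one_le
  have hqQ : (q : ℝ) ≤ Q := by exact_mod_cast inv.q_le
  have hnq : (q : ℝ) ≤ n := by exact_mod_cast hn1.1
  refine ⟨hk.symm.trans hk0, by omega, ?_, ?_, ?_⟩
  · have : (n : ℝ) ≤ q + ((t + 1 : ℕ) : ℝ) := by exact_mod_cast hn1.2
    linarith
  · refine hq.trans ?_
    gcongr
  · have h1 := g.exploitRate_nonneg
    have h2 : 0 ≤ Real.log n := Real.log_natCast_nonneg n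
    have := mul_nonneg h1 h2
    linarith

lemma exploit_block {b n : ℕ} {k : Fin K} (hb : state p x b = .exploit k n)
    (inv : ExploitInv p z x μ k₀ Δ w Q b k n) (hT : startTime (blocks p x) b ≤ p.T) :
    (blocks p x b).arms ≠ [] ∧
    lag p z x μ (μ k₀) (b + 1) ≤ identifyRegret K p z (μ k₀) Δ + exploitRate p w (μ k₀) *
      Real.log ((n + ⌈empMean x k n * p.T ^ p.ν / 2⌉₊ : ℕ) : ℝ) ∧
    ((n + ⌈empMean x k n * p.T ^ p.ν / 2⌉₊ : ℕ) : ℝ) ≤ (w + 2) * M ∧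
    ((n + ⌈empMean x k n * p.T ^ p.ν / 2⌉₊ : ℕ) : ℝ) ≤ Q + startTime (blocks p x) (b + 1) := by
  obtain rfl := inv.arm
  have hm := g.best.mean_pos
  have hTν : 0 < p.T ^ p.ν := Real.rpow_pos_of_pos g.adm.T_pos _
  have hnM : (n : ℝ) ≤ M := by
    have := inv.n_le
    have := g.le_M
    linarith
  have hnM' : n ≤ M := by exact_mod_cast hnM
  obtain ⟨h1, h2, -⟩ := g.exploit_bounds inv.one_le hnM' inv.le_n
  obtain ⟨h3, h4⟩ := g.exploit_step inv.one_le hnM' inv.le_n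
  set e := empMean x k n with he
  have he0 : 0 < e := by linarith
  set N := ⌈e * p.T ^ p.ν / 2⌉₊ with hN
  have hN0 : 0 < N := Nat.ceil_pos.2 (by positivity)
  have hblock : blocks p x b = ⟨2 / e, List.replicate N k⟩ := blocks_exploit hb
  have hne : (blocks p x b).arms ≠ [] := by
    rw [hblock]
    simp only [ne_eq, List.replicate_eq_nil_iff]
    omega
  have hgap : 2 / e ≤ 6 / μ k := by
    rw [div_le_div_iff₀ he0 hm]
    linarith
  -- The loss per play comes from completing the square: m²/4 · 2/e - (m - e/2) = (m-e)²/(2e).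
  have h5 := g.lag_succ_le (b := b) (ρ := (μ k - e) ^ 2 / (2 * e)) (by positivity)
    (by rw [hblock]; simp only; positivity) (by rw [hblock]; exact g.le_gapBound hgap)
    (by
      rw [hblock]
      intro a ha
      rw [List.eq_of_mem_replicate ha]
      simp only
      refine le_of_eq ?_
      field_simp
      ring)
  have h6 := one_le_gap hne (by simp [hb])
  have h7 : (blocks p x b).arms.length = N := by rw [hblock]; simp
  rw [h7] at h5
  refine ⟨hne, ?_, h4.trans ?_, ?_⟩
  · have := inv.lag_le
    linarith
  · have := g.w_pos
    gcongr
  -- Plays are at distance at least 1, so n grows no faster than time; this keeps n below M before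
  -- time T.
  · have h8 := inv.n_le
    rw [startTime_succ, h7]
    push_cast
    nlinarith [(Nat.cast_nonneg N : (0 : ℝ) ≤ N)]

lemma state_inv (b : ℕ) (hT : startTime (blocks p x) b ≤ p.T) :
    (∀ q t u, state p x b = .identify q t u → IdentifyInv p z x μ k₀ Δ Q b q t u) ∧
      ∀ k n, state p x b = .exploit k n → ExploitInv p z x μ k₀ Δ w Q b k n := by
  induction b with
  | zero => simp [state]
  | succ b ih =>
    have hTb := (startTime_le_succ g.adm b).trans hT
    obtain ⟨ih1, ih2⟩ := ih hTb
    rcases hb : state p x b with ⟨i, r, q⟩ | ⟨q, t, u⟩ | ⟨k, n⟩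
    · refine ⟨fun q' t' u' hb' => g.identify_init hb hb', fun k n hb' => ?_⟩
      rw [state_succ, hb] at hb'
      unfold nextState at hb'
      simp only at hb'
      split_ifs at hb'
    · exact ⟨fun q' t' u' hb' => g.identify_step hb (ih1 _ _ _ hb) hT hb',
        fun k n hb' => g.exploit_init hb (ih1 _ _ _ hb) hT hb'⟩
    · have hb1 : state p x (b + 1) = .exploit k (n + ⌈empMean x k n * p.T ^ p.ν / 2⌉₊) := by
        rw [state_succ, hb]; rfl
      have inv := ih2 _ _ hb
      obtain ⟨-, h1, -, h2⟩ := g.exploit_block hb inv hTb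
      refine ⟨fun q' t' u' hb' => by simp [hb1] at hb', fun k' n' hb' => ?_⟩
      rw [hb1] at hb'
      simp only [State.exploit.injEq] at hb'
      obtain ⟨rfl, rfl⟩ := hb'
      refine ⟨inv.arm, by have := inv.one_le; omega, h2, inv.le_n.trans ?_, h1⟩
      push_cast
      gcongr
      simp

lemma one_le_M : 1 ≤ M := g.one_le_Q.trans g.Q_le_M

lemma lag_succ_le_runRegret {b : ℕ} (hT : startTime (blocks p x) b ≤ p.T) :
    lag p z x μ (μ k₀) (b + 1) ≤ runRegret K p z (μ k₀) Δ w M := by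
  have hm := g.best.mean_pos
  have h0 := g.identifyRegret_le_runRegret g.one_le_M
  obtain ⟨h1, h2⟩ := g.state_inv b hT
  rcases hb : state p x b with ⟨i, r, q⟩ | ⟨q, t, u⟩ | ⟨k, n⟩
  · refine (g.estimate_lag_le hb).trans (le_trans ?_ h0)
    have : 0 ≤ 2 * μ k₀ * (K + 2 * (K * lucbCount p.T Δ + 1)) := by positivity
    unfold identifyRegret
    linarith
  · exact (g.identify_lag_succ_le hb (h1 _ _ _ hb)).trans h0
  · obtain ⟨-, h3, h4, -⟩ := g.exploit_block hb (h2 _ _ hb) hT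
    refine h3.trans ?_
    have h5 := g.exploitRate_nonneg
    have h6 := (h2 _ _ hb).one_le
    unfold runRegret
    gcongr

lemma lag_le_runRegret (b : ℕ) : lag p z x μ (μ k₀) b ≤ runRegret K p z (μ k₀) Δ w M := by
  induction b with
  | zero =>
    have hm := g.best.mean_pos
    have h0 := g.identifyRegret_le_runRegret g.one_le_M
    have h1 := g.estimateRegret_nonneg
    have h2 : 0 ≤ 2 * μ k₀ * (K + 2 * (K * lucbCount p.T Δ + 1)) := by positivity
    have h3 : lag p z x μ (μ k₀) 0 ≤ 0 := by
      have : min (startTime (blocks p x) 0) (p.T - gapBound z (μ k₀)) ≤ 0 := by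
        refine (min_le_left _ _).trans ?_
        simp [startTime]
      have : μ k₀ ^ 2 / 4 * min (startTime (blocks p x) 0) (p.T - gapBound z (μ k₀)) ≤ 0 :=
        mul_nonpos_of_nonneg_of_nonpos (by positivity) this
      simpa [lag, partialPayoff] using this
    unfold identifyRegret at h0
    linarith
  | succ b ih =>
    rcases le_or_gt (startTime (blocks p x) b) p.T with hT | hT
    · exact g.lag_succ_le_runRegret hT
    · have hG : 0 ≤ gapBound z (μ k₀) := by
        have := g.le_gapBound (y := 0) (by have := g.best.mean_pos; positivity)
        exact this
      have h1 := startTime_le_succ (x := x) g.adm b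
      refine le_trans (le_of_eq ?_) ih
      unfold lag
      rw [partialPayoff_succ, blockPayoff_eq_zero_of_lt g.adm μ hT, add_zero,
        min_eq_right (by linarith), min_eq_right (by linarith)]

lemma arms_ne_nil {b : ℕ} (hT : startTime (blocks p x) b ≤ p.T) : (blocks p x b).arms ≠ [] := by
  obtain ⟨h1, h2⟩ := g.state_inv b hT
  have hK := g.best.two_le
  rcases hb : state p x b with ⟨i, r, q⟩ | ⟨q, t, u⟩ | ⟨k, n⟩
  · rw [blocks_estimate hb]
    simp only [ne_eq, List.finRange_eq_nil_iff]
    omega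
  · exact (g.identify_startTime hb (h1 _ _ _ hb)).1
  · exact (g.exploit_block hb (h2 _ _ hb) hT).1

/-- The regret on accurate rewards. -/
lemma regret_le :
    μ k₀ ^ 2 * p.T / 4 - payoff μ p.T (blocks p x)
      ≤ runRegret K p z (μ k₀) Δ w M + μ k₀ ^ 2 / 4 * gapBound z (μ k₀) := by
  -- On accurate rewards no block starting before T is empty, so the run does pass T and its final
  -- lag measures the full horizon up to the last distance.
  have hT : p.T < startTime (blocks p x) (blockBound p z) := by
    by_contra hle
    rw [not_lt] at hle
    refine absurd (T_lt_startTime (x := x) g.adm le_rfl fun i hi => g.arms_ne_nil ?_)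
      (not_lt.2 hle)
    exact (startTime_mono g.adm hi.le).trans hle
  have hG : 0 ≤ gapBound z (μ k₀) :=
    g.le_gapBound (y := 0) (by have := g.best.mean_pos; positivity)
  have h1 := g.lag_le_runRegret (blockBound p z)
  unfold lag at h1
  rw [min_eq_right (by linarith)] at h1
  rw [payoff_eq_partialPayoff g.adm g.best.two_le]
  linarith

end GoodRun

/-! ### The payoff is a function of finitely many rewards -/

/-- `f` depends only on the first `M` rewards of every arm. -/
def DependsOnFirst {K : ℕ} {α : Type*} (f : Rewards K → α) (M : ℕ) : Prop :=
  ∀ x y : Rewards K, (∀ a, ∀ n < M, x a n = y a n) → f x = f y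

section

variable {K : ℕ} {α : Type*}

/-- The table that agrees with `v` on the first `M` rewards. -/
def extendTable {M : ℕ} (v : Fin K → Fin M → Bool) : Rewards K :=
  fun a n => if h : n < M then v a ⟨n, h⟩ else false

lemma DependsOnFirst.eq_extendTable {f : Rewards K → α} {M : ℕ} (hf : DependsOnFirst f M)
    (x : Rewards K) : f x = f (extendTable fun a (n : Fin M) => x a n) := by
  refine hf _ _ fun a n hn => ?_
  simp [extendTable, hn]

lemma DependsOnFirst.finite_range {f : Rewards K → α} {M : ℕ} (hf : DependsOnFirst f M) :
    (Set.range f).Finite := by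
  refine (Set.finite_range fun v : Fin K → Fin M → Bool => f (extendTable v)).subset ?_
  rintro _ ⟨x, rfl⟩
  exact ⟨_, (hf.eq_extendTable x).symm⟩

lemma DependsOnFirst.measurable [MeasurableSpace α] {f : Rewards K → α} {M : ℕ}
    (hf : DependsOnFirst f M) {Ω : Type*} [MeasurableSpace Ω] {X : Fin K → ℕ → Ω → Bool}
    (hX : ∀ a n, Measurable (X a n)) : Measurable fun ω => f fun a n => X a n ω := by
  have h1 : (fun ω => f fun a n => X a n ω)
      = (fun v : Fin K → Fin M → Bool => f (extendTable v))
        ∘ fun ω a (n : Fin M) => X a n ω := by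
    funext ω
    exact hf.eq_extendTable _
  rw [h1]
  refine (measurable_of_finite _).comp ?_
  exact measurable_pi_lambda _ fun a => measurable_pi_lambda _ fun n => hX a n

lemma empMean_congr {x y : Rewards K} {a : Fin K} {n : ℕ} (h : ∀ j < n, x a j = y a j) :
    empMean x a n = empMean y a n := by
  unfold empMean
  congr 1
  exact Finset.sum_congr rfl fun j hj => by rw [h j (Finset.mem_range.1 hj)]

lemma lucbHigh_congr [NeZero K] {x y : Rewards K} {u : Fin K → ℕ}
    (h : ∀ a, empMean x a (u a) = empMean y a (u a)) : lucbHigh x u = lucbHigh y u := by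
  unfold lucbHigh
  simp only [h]

lemma lucbLow_congr [NeZero K] {x y : Rewards K} {u : Fin K → ℕ} (δ : ℝ) (t : ℕ)
    (h : ∀ a, empMean x a (u a) = empMean y a (u a)) : lucbLow x δ u t = lucbLow y δ u t := by
  unfold lucbLow
  simp only [h, lucbHigh_congr h]

lemma lucbArms_congr [NeZero K] {x y : Rewards K} {u : Fin K → ℕ} (δ : ℝ) (t : ℕ)
    (h : ∀ a, empMean x a (u a) = empMean y a (u a)) : lucbArms x δ u t = lucbArms y δ u t := by
  unfold lucbArms
  rw [lucbHigh_congr h, lucbLow_congr δ t h]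

lemma lucbStop_congr [NeZero K] {x y : Rewards K} {u : Fin K → ℕ} (δ : ℝ) (t : ℕ)
    (h : ∀ a, empMean x a (u a) = empMean y a (u a)) : LucbStop x δ u t ↔ LucbStop y δ u t := by
  unfold LucbStop
  rw [lucbHigh_congr h, lucbLow_congr δ t h, h, h]

lemma estStop_congr {x y : Rewards K} (δ : ℝ) {q : ℕ}
    (h : ∀ a, empMean x a q = empMean y a q) : EstStop x δ q ↔ EstStop y δ q := by
  unfold EstStop
  simp only [h]

lemma bestEstimate_congr [NeZero K] {x y : Rewards K} {q : ℕ}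
    (h : ∀ a, empMean x a q = empMean y a q) : bestEstimate x q = bestEstimate y q := by
  unfold bestEstimate
  simp only [h]

lemma length_lucbArms_le [NeZero K] (x : Rewards K) (δ : ℝ) (u : Fin K → ℕ) (t : ℕ) :
    (lucbArms x δ u t).length ≤ K + 2 := by
  unfold lucbArms
  split_ifs <;> simp

/-- A number of rewards of every arm that determines the next block and the next state. -/
def horizon [NeZero K] : State K → ℕ
  | .estimate _ _ q => q + 1
  | .identify q _ u => q + (∑ a, u a + (K + 2))
  | .exploit _ n => n

lemma drop_empMean_congr {x y : Rewards K} {q m : ℕ}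
    (h : ∀ a, ∀ n < q + m, x a n = y a n) {a : Fin K} {n : ℕ} (hn : n ≤ m) :
    empMean (x.drop q) a n = empMean (y.drop q) a n :=
  empMean_congr fun j hj => h a _ (by omega)

lemma nextBlock_congr [NeZero K] (p : Params) (s : State K) :
    DependsOnFirst (fun x => nextBlock p x s) (horizon s) := by
  intro x y hxy
  rcases s with ⟨i, r, q⟩ | ⟨q, t, u⟩ | ⟨k, n⟩
  · rfl
  · simp only [horizon] at hxy
    have h1 : ∀ a, empMean (x.drop q) a (u a) = empMean (y.drop q) a (u a) := fun a =>
      drop_empMean_congr hxy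
        ((Finset.single_le_sum (fun _ _ => Nat.zero_le _) (Finset.mem_univ a)).trans (by omega))
    have h2 : ∀ a, empMean x a q = empMean y a q := fun a =>
      empMean_congr fun j hj => hxy a j (by omega)
    simp only [nextBlock]
    rw [lucbArms_congr p.δ t h1, bestEstimate_congr h2]
  · simp only [nextBlock]
    rw [empMean_congr (n := n) fun j hj => hxy k j hj]

lemma nextState_congr [NeZero K] (p : Params) (s : State K) :
    DependsOnFirst (fun x => nextState p x s) (horizon s) := by
  intro x y hxy
  rcases s with ⟨i, r, q⟩ | ⟨q, t, u⟩ | ⟨k, n⟩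
  · have h1 := estStop_congr (x := x) (y := y) p.δ (q := q + 1) fun a =>
      empMean_congr fun j hj => hxy a j hj
    simp only [nextState]
    rw [propext h1]
  · simp only [horizon] at hxy
    have hu : ∀ a, u a ≤ ∑ a, u a := fun a =>
      Finset.single_le_sum (fun _ _ => Nat.zero_le _) (Finset.mem_univ a)
    have h1 : ∀ a, empMean (x.drop q) a (u a) = empMean (y.drop q) a (u a) := fun a =>
      drop_empMean_congr hxy ((hu a).trans (by omega))
    have h2 := lucbArms_congr p.δ t h1
    have h3 : ∀ a, empMean (x.drop q) a (u a + (lucbArms (y.drop q) p.δ u t).count a)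
        = empMean (y.drop q) a (u a + (lucbArms (y.drop q) p.δ u t).count a) := fun a => by
      refine drop_empMean_congr hxy ?_
      have h4 := length_lucbArms_le (y.drop q) p.δ u t
      have h5 := List.count_le_length (a := a) (l := lucbArms (y.drop q) p.δ u t)
      have h6 := hu a
      omega
    simp only [nextState]
    rw [h2, propext (lucbStop_congr p.δ (t + 1) h3), lucbHigh_congr h3]
  · simp only [nextState]
    rw [empMean_congr (n := n) fun j hj => hxy k j hj]

/-- A function of finitely many binary rewards takes finitely many values, so the ranges needed for
its values have a maximum, even though the continuation depends on the value. -/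
lemma DependsOnFirst.bind {β : Type*} {f : Rewards K → α} {M : ℕ} (hf : DependsOnFirst f M)
    {F : Rewards K → α → β} (hF : ∀ s, ∃ N, DependsOnFirst (fun x => F x s) N) :
    ∃ N, DependsOnFirst (fun x => F x (f x)) N := by
  choose N hN using hF
  refine ⟨max M (hf.finite_range.toFinset.sup N), fun x y hxy => ?_⟩
  have h1 : f x = f y := hf x y fun a n hn => hxy a n (hn.trans_le (le_max_left _ _))
  simp only [h1]
  refine hN (f y) x y fun a n hn => hxy a n (hn.trans_le (le_max_of_le_right ?_))
  exact Finset.le_sup (f := N) (by simp)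

lemma exists_dependsOnFirst_state [NeZero K] (p : Params) (b : ℕ) :
    ∃ N, DependsOnFirst (fun x : Rewards K => state p x b) N := by
  induction b with
  | zero => exact ⟨0, fun _ _ _ => rfl⟩
  | succ b ih =>
    obtain ⟨N, hN⟩ := ih
    exact hN.bind (F := fun x s => nextState p x s) fun s => ⟨_, nextState_congr p s⟩

lemma exists_dependsOnFirst_blocks [NeZero K] (p : Params) (b : ℕ) :
    ∃ N, DependsOnFirst (fun x : Rewards K => blocks p x b) N := by
  obtain ⟨N, hN⟩ := exists_dependsOnFirst_state (K := K) p b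
  exact hN.bind (F := fun x s => nextBlock p x s) fun s => ⟨_, nextBlock_congr p s⟩

lemma exists_dependsOnFirst_partialPayoff [NeZero K] (p : Params) (μ : Fin K → ℝ) (b : ℕ) :
    ∃ N, DependsOnFirst (fun x : Rewards K => partialPayoff μ p.T (blocks p x) b) N := by
  choose N hN using exists_dependsOnFirst_blocks (K := K) p
  refine ⟨(Finset.range b).sup N, fun x y hxy => ?_⟩
  have h1 : ∀ i < b, blocks p x i = blocks p y i := fun i hi =>
    hN i x y fun a n hn => hxy a n (hn.trans_le (Finset.le_sup (f := N) (Finset.mem_range.2 hi)))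
  refine Finset.sum_congr rfl fun i hi => ?_
  have hi' := Finset.mem_range.1 hi
  have h2 : startTime (blocks p x) i = startTime (blocks p y) i :=
    Finset.sum_congr rfl fun j hj => by rw [h1 j ((Finset.mem_range.1 hj).trans hi')]
  unfold blockPayoff
  rw [h2, h1 i hi']

lemma integrable_payoff [NeZero K] {p : Params} {z : ℝ} (h : p.Admissible z) (hK : 2 ≤ K)
    (μ : Fin K → ℝ) {Ω : Type*} [MeasurableSpace Ω] (P : Measure Ω) [IsFiniteMeasure P]
    {X : Fin K → ℕ → Ω → Bool} (hX : ∀ a n, Measurable (X a n)) :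
    Integrable (fun ω => payoff μ p.T (blocks p fun a n => X a n ω)) P := by
  simp only [payoff_eq_partialPayoff h hK]
  obtain ⟨N, hN⟩ := exists_dependsOnFirst_partialPayoff p μ (blockBound p z)
  obtain ⟨C, hC⟩ := hN.finite_range.isBounded.exists_norm_le
  refine Integrable.of_bound (hN.measurable hX).aestronglyMeasurable C
    (Filter.Eventually.of_forall fun ω => hC _ ⟨_, rfl⟩)

end

/-! ### Concentration of the empirical means -/

section

variable {K : ℕ} {Ω : Type*} [MeasurableSpace Ω] {P : Measure Ω} [IsProbabilityMeasure P]
  {X : Fin K → ℕ → Ω → Bool} {μ : Fin K → ℝ}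

/-- The reward, as a real number, minus its mean. -/
def centered (μ : Fin K → ℝ) (X : Fin K → ℕ → Ω → Bool) (i : Fin K × ℕ) (ω : Ω) : ℝ :=
  (if X i.1 i.2 ω then 1 else 0) - μ i.1

lemma centered_eq_comp (μ : Fin K → ℝ) (X : Fin K → ℕ → Ω → Bool) (i : Fin K × ℕ) :
    centered μ X i = (fun b : Bool => (if b then (1 : ℝ) else 0) - μ i.1) ∘ X i.1 i.2 := rfl

lemma measurable_centered (hX : ∀ a n, Measurable (X a n)) (i : Fin K × ℕ) :
    Measurable (centered μ X i) := by
  rw [centered_eq_comp]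
  exact (measurable_of_finite _).comp (hX _ _)

lemma hasSubgaussianMGF_centered (hX : ∀ a n, Measurable (X a n))
    (hmean : ∀ a n, P.real {ω | X a n ω = true} = μ a) (i : Fin K × ℕ) :
    HasSubgaussianMGF (centered μ X i) (1 / 4) P := by
  have hs : MeasurableSet {ω | X i.1 i.2 ω = true} := hX i.1 i.2 (measurableSet_singleton true)
  have h1 := hasSubgaussianMGF_of_mem_Icc_of_integral_eq_zero (a := -μ i.1) (b := 1 - μ i.1)
    (measurable_centered (μ := μ) hX i).aemeasurable (μ := P) (X := centered μ X i) ?_ ?_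
  · convert h1 using 1
    simp only [sub_neg_eq_add, sub_add_cancel, nnnorm_one]
    norm_num
  · refine Filter.Eventually.of_forall fun ω => ?_
    unfold centered
    split_ifs <;> constructor <;> linarith
  · have h2 : centered μ X i
        = fun ω => {ω | X i.1 i.2 ω = true}.indicator (fun _ => (1 : ℝ)) ω - μ i.1 := by
      funext ω
      simp [centered, Set.indicator_apply]
    rw [h2, integral_sub ((integrable_const _).indicator hs) (integrable_const _),
      integral_indicator_const _ hs, integral_const, hmean]
    simp

lemma sum_centered (a : Fin K) (q n : ℕ) (hn : 1 ≤ n) (ω : Ω) :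
    ∑ j ∈ Finset.range n, centered μ X (a, q + j) ω
      = n * (empMean (Rewards.drop (fun a n => X a n ω) q) a n - μ a) := by
  have hn0 : (n : ℝ) ≠ 0 := by
    have : n ≠ 0 := by omega
    exact_mod_cast this
  unfold centered empMean Rewards.drop
  rw [Finset.sum_sub_distrib, mul_sub, mul_div_cancel₀ _ hn0]
  simp

/-- Hoeffding's inequality for the empirical means. -/
lemma measure_empMean_le (hX : ∀ a n, Measurable (X a n))
    (hind : iIndepFun (fun i : Fin K × ℕ => X i.1 i.2) P)
    (hmean : ∀ a n, P.real {ω | X a n ω = true} = μ a) (a : Fin K) (q n : ℕ) (hn : 1 ≤ n)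
    {s : ℝ} (hs : 0 ≤ s) :
    P.real {ω | s ≤ |empMean (Rewards.drop (fun a n => X a n ω) q) a n - μ a|}
      ≤ 2 * Real.exp (-(2 * n * s ^ 2)) := by
  have hn0 : (0 : ℝ) < n := by exact_mod_cast hn
  have hind1 : iIndepFun (fun i => centered μ X i) P :=
    hind.comp (fun i (b : Bool) => (if b then (1 : ℝ) else 0) - μ i.1)
      fun i => measurable_of_finite _
  have hinj : Function.Injective fun j : ℕ => (a, q + j) := fun i j hij => by
    simpa using hij
  have hind2 := hind1.precomp hinj
  have hsub : ∀ j < n, HasSubgaussianMGF (centered μ X (a, q + j)) (1 / 4) P := fun j _ =>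
    hasSubgaussianMGF_centered hX hmean _
  have hexp : Real.exp (-(n * s) ^ 2 / (2 * n * ((1 / 4 : NNReal) : ℝ)))
      = Real.exp (-(2 * n * s ^ 2)) := by
    congr 1
    push_cast
    field_simp
    ring
  have h1 := HasSubgaussianMGF.measure_sum_range_ge_le_of_iIndepFun hind2 hsub
    (ε := n * s) (by positivity)
  have hind3 : iIndepFun (fun j : ℕ => -centered μ X (a, q + j)) P :=
    hind2.comp (fun _ y => -y) fun _ => measurable_neg
  have h2 := HasSubgaussianMGF.measure_sum_range_ge_le_of_iIndepFun hind3
    (fun j hj => (hsub j hj).neg) (ε := n * s) (by positivity)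
  rw [hexp] at h1 h2
  have hsubset : {ω | s ≤ |empMean (Rewards.drop (fun a n => X a n ω) q) a n - μ a|}
      ⊆ {ω | n * s ≤ ∑ j ∈ Finset.range n, centered μ X (a, q + j) ω}
        ∪ {ω | n * s ≤ ∑ j ∈ Finset.range n, (-centered μ X (a, q + j)) ω} := by
    intro ω hω
    have h3 := sum_centered (μ := μ) (X := X) a q n hn ω
    rw [Set.mem_ofPred_eq] at hω
    rcases le_abs.1 hω with h4 | h4
    · left
      rw [Set.mem_ofPred_eq]
      rw [h3]
      gcongr
    · right
      rw [Set.mem_ofPred_eq]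
      simp only [Pi.neg_apply, Finset.sum_neg_distrib]
      rw [h3, ← mul_neg]
      gcongr
  calc _ ≤ _ := measureReal_mono hsubset
    _ ≤ _ := measureReal_union_le _ _
    _ ≤ _ := by
      rw [two_mul]
      exact add_le_add h1 h2

lemma drop_zero (x : Rewards K) : x.drop 0 = x := by
  funext a n
  simp [Rewards.drop]

lemma measurable_empMean_drop (hX : ∀ a n, Measurable (X a n)) (a : Fin K) (q n : ℕ) :
    Measurable fun ω => empMean (Rewards.drop (fun a n => X a n ω) q) a n := by
  unfold empMean Rewards.drop
  refine Measurable.div_const (Finset.measurable_sum _ fun j _ => ?_) _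
  exact (measurable_of_finite fun b : Bool => if b then (1 : ℝ) else 0).comp (hX _ _)

/-- The empirical mean of `n` plays of arm `a` is inaccurate. -/
def inaccurate (δ : ℝ) (μ : Fin K → ℝ) (X : Fin K → ℕ → Ω → Bool) (a : Fin K) (n : ℕ) : Set Ω :=
  {ω | 3 / 4 * Real.sqrt (Real.log (2 / δ) / n) ≤ |empMean (fun a n => X a n ω) a n - μ a|}

/-- The empirical mean that LUCB1 computes for `u` plays of arm `a`, when it starts after `q` plays
of each arm, is outside its confidence interval. -/
def lucbInaccurate (δ : ℝ) (μ : Fin K → ℝ) (X : Fin K → ℕ → Ω → Bool) (q : ℕ) (a : Fin K) (u : ℕ) :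
    Set Ω :=
  {ω | lucbWidth K δ u u < |empMean (Rewards.drop (fun a n => X a n ω) q) a u - μ a|}

/-- Some empirical mean is inaccurate. -/
def badEvent (δ : ℝ) (μ : Fin K → ℝ) (X : Fin K → ℕ → Ω → Bool) (Q M : ℕ) : Set Ω :=
  (⋃ i ∈ (Finset.univ : Finset (Fin K)) ×ˢ Finset.Icc 1 M, inaccurate δ μ X i.1 i.2) ∪
    ⋃ i ∈ Finset.range (Q + 1) ×ˢ (Finset.univ : Finset (Fin K)) ×ˢ Finset.Icc 1 M,
      lucbInaccurate δ μ X i.1 i.2.1 i.2.2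

lemma measurableSet_inaccurate (hX : ∀ a n, Measurable (X a n)) (δ : ℝ) (a : Fin K) (n : ℕ) :
    MeasurableSet (inaccurate δ μ X a n) := by
  have h1 := measurable_empMean_drop hX a 0 n
  simp only [drop_zero] at h1
  exact measurableSet_le measurable_const (continuous_abs.measurable.comp (h1.sub_const _))

lemma measurableSet_badEvent (hX : ∀ a n, Measurable (X a n)) (δ : ℝ) (Q M : ℕ) :
    MeasurableSet (badEvent δ μ X Q M) := by
  refine MeasurableSet.union ?_ ?_
  · exact Finset.measurableSet_biUnion _ fun i _ => measurableSet_inaccurate hX δ _ _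
  · exact Finset.measurableSet_biUnion _ fun i _ =>
      measurableSet_lt measurable_const
        (continuous_abs.measurable.comp ((measurable_empMean_drop hX _ _ _).sub_const _))

variable {p : Params} {z : ℝ}

lemma measure_inaccurate_le (h : p.Admissible z) (hX : ∀ a n, Measurable (X a n))
    (hind : iIndepFun (fun i : Fin K × ℕ => X i.1 i.2) P)
    (hmean : ∀ a n, P.real {ω | X a n ω = true} = μ a) (a : Fin K) {n : ℕ} (hn : 1 ≤ n) :
    P.real (inaccurate p.δ μ X a n) ≤ 1 / p.T ^ 2 := by
  have hl := h.one_lt_log_two_div_delta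
  have hT := h.T_pos
  have hn0 : (0 : ℝ) < n := by exact_mod_cast hn
  have h1 := measure_empMean_le hX hind hmean a 0 n hn
    (s := 3 / 4 * Real.sqrt (Real.log (2 / p.δ) / n)) (by positivity)
  simp only [drop_zero] at h1
  refine h1.trans ?_
  have h2 : (0 : ℝ) ≤ Real.log (2 / p.δ) / n := by positivity
  -- The factor 3/4 is small enough for the stopping rule, and its square still gives the exponent
  -- 9/8 ≥ 1 in Hoeffding's inequality.
  have h3 : 2 * n * (3 / 4 * Real.sqrt (Real.log (2 / p.δ) / n)) ^ 2
      = 9 / 8 * Real.log (2 / p.δ) := by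
    rw [mul_pow, Real.sq_sqrt h2]
    field_simp
    norm_num
  rw [h3]
  calc 2 * Real.exp (-(9 / 8 * Real.log (2 / p.δ)))
      ≤ 2 * Real.exp (-Real.log (2 / p.δ)) := by
        gcongr
        linarith
    _ = 1 / p.T ^ 2 := by
        rw [Real.exp_neg, h.two_div_delta, Real.exp_log (by positivity)]
        field_simp

/-- The factor K u⁴ inside the logarithm turns Hoeffding's bound into a constant times 1/(K u⁴ T²),
so that the sums over arms and over u cost only a constant. -/
lemma measure_lucbInaccurate_le (h : p.Admissible z) (hK : 1 ≤ K) (hX : ∀ a n, Measurable (X a n))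
    (hind : iIndepFun (fun i : Fin K × ℕ => X i.1 i.2) P)
    (hmean : ∀ a n, P.real {ω | X a n ω = true} = μ a) (q : ℕ) (a : Fin K) {u : ℕ} (hu : 1 ≤ u) :
    P.real (lucbInaccurate p.δ μ X q a u) ≤ 8 / 5 / (K * p.T ^ 2) * ((u : ℝ) ^ 2)⁻¹ := by
  have hT := h.T_pos
  have hT2 := h.two_le
  have hK' : (1 : ℝ) ≤ K := by exact_mod_cast hK
  have hu' : (1 : ℝ) ≤ u := by exact_mod_cast hu
  have h1 := measure_empMean_le hX hind hmean a q u hu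
    (s := lucbWidth K p.δ u u) (lucbWidth_nonneg _ _ _ _)
  have h2 : lucbInaccurate p.δ μ X q a u
      ⊆ {ω | lucbWidth K p.δ u u
          ≤ |empMean (Rewards.drop (fun a n => X a n ω) q) a u - μ a|} := by
    intro ω hω
    rw [lucbInaccurate, Set.mem_ofPred_eq] at hω
    exact hω.le
  refine ((measureReal_mono h2).trans h1).trans ?_
  set y := 5 / 4 * (K : ℝ) * (u : ℝ) ^ 4 / p.δ with hy
  have hy' : y = 5 / 4 * (K : ℝ) * (u : ℝ) ^ 4 * p.T ^ 2 := by
    rw [hy, h.delta, div_div_eq_mul_div, div_one]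
  have hy1 : 1 ≤ y := by
    rw [hy']
    have h3 : 1 ≤ (u : ℝ) ^ 4 := one_le_pow₀ hu'
    have h4 : 1 ≤ p.T ^ 2 := one_le_pow₀ (by linarith)
    have h5 : 1 ≤ (K : ℝ) * (u : ℝ) ^ 4 := one_le_mul_of_one_le_of_one_le hK' h3
    have h6 := one_le_mul_of_one_le_of_one_le h5 h4
    linarith
  have h3 : 2 * u * lucbWidth K p.δ u u ^ 2 = Real.log y := by
    unfold lucbWidth
    rw [← hy, Real.sq_sqrt (div_nonneg (Real.log_nonneg hy1) (by positivity))]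
    field_simp
  rw [h3, Real.exp_neg, Real.exp_log (by linarith), hy']
  have h4 : ((u : ℝ) ^ 4)⁻¹ ≤ ((u : ℝ) ^ 2)⁻¹ := by
    gcongr
    norm_num
  calc 2 * (5 / 4 * (K : ℝ) * (u : ℝ) ^ 4 * p.T ^ 2)⁻¹
      = 8 / 5 / (K * p.T ^ 2) * ((u : ℝ) ^ 4)⁻¹ := by
        field_simp
        norm_num
    _ ≤ _ := by gcongr

lemma sum_inv_sq_le_two (M : ℕ) : ∑ u ∈ Finset.Icc 1 M, ((u : ℝ) ^ 2)⁻¹ ≤ 2 := by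
  have h : ∀ M : ℕ, 1 ≤ M → ∑ u ∈ Finset.Icc 1 M, ((u : ℝ) ^ 2)⁻¹ ≤ 2 - 1 / M := by
    intro M hM
    induction M, hM using Nat.le_induction with
    | base => norm_num
    | succ n hn ih =>
      rw [Finset.sum_Icc_succ_top (by omega)]
      have hn0 : (0 : ℝ) < n := by exact_mod_cast hn
      have h1 : (((n + 1 : ℕ) : ℝ) ^ 2)⁻¹ ≤ 1 / n - 1 / ((n + 1 : ℕ) : ℝ) := by
        push_cast
        rw [div_sub_div _ _ hn0.ne' (by positivity), inv_eq_one_div,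
          div_le_div_iff₀ (by positivity) (by positivity)]
        nlinarith
      linarith
  rcases Nat.eq_zero_or_pos M with rfl | hM
  · simp
  · have := h M hM
    have : (0 : ℝ) ≤ 1 / M := by positivity
    linarith

/-- The number q of rewards used before LUCB1 starts is random, so the second union runs over all q
≤ Q; each q contributes at most 4/T². -/
lemma measure_badEvent_le (h : p.Admissible z) (hK : 1 ≤ K) (hX : ∀ a n, Measurable (X a n))
    (hind : iIndepFun (fun i : Fin K × ℕ => X i.1 i.2) P)
    (hmean : ∀ a n, P.real {ω | X a n ω = true} = μ a) (Q M : ℕ) :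
    P.real (badEvent p.δ μ X Q M) ≤ (K * M + 4 * (Q + 1)) / p.T ^ 2 := by
  have hT := h.T_pos
  have hK' : (0 : ℝ) < K := by exact_mod_cast hK
  have h1 : P.real (⋃ i ∈ (Finset.univ : Finset (Fin K)) ×ˢ Finset.Icc 1 M,
      inaccurate p.δ μ X i.1 i.2) ≤ K * M / p.T ^ 2 := by
    refine (measureReal_biUnion_finset_le _ _).trans ?_
    calc _ ≤ ∑ _i ∈ (Finset.univ : Finset (Fin K)) ×ˢ Finset.Icc 1 M, 1 / p.T ^ 2 := by
          refine Finset.sum_le_sum fun i hi => ?_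
          simp only [Finset.mem_product, Finset.mem_univ, true_and, Finset.mem_Icc] at hi
          exact measure_inaccurate_le h hX hind hmean _ hi.1
      _ = _ := by
          simp
          ring
  have h2 : P.real (⋃ i ∈ Finset.range (Q + 1) ×ˢ (Finset.univ : Finset (Fin K)) ×ˢ
      Finset.Icc 1 M, lucbInaccurate p.δ μ X i.1 i.2.1 i.2.2) ≤ 4 * (Q + 1) / p.T ^ 2 := by
    refine (measureReal_biUnion_finset_le _ _).trans ?_
    calc _ ≤ ∑ i ∈ Finset.range (Q + 1) ×ˢ (Finset.univ : Finset (Fin K)) ×ˢ Finset.Icc 1 M,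
            8 / 5 / (K * p.T ^ 2) * ((i.2.2 : ℝ) ^ 2)⁻¹ := by
          refine Finset.sum_le_sum fun i hi => ?_
          simp only [Finset.mem_product, Finset.mem_univ, true_and, Finset.mem_Icc] at hi
          exact measure_lucbInaccurate_le h hK hX hind hmean _ _ hi.2.1
      _ = (Q + 1) * (K * (8 / 5 / (K * p.T ^ 2) * ∑ u ∈ Finset.Icc 1 M, ((u : ℝ) ^ 2)⁻¹)) := by
          rw [Finset.sum_product, Finset.mul_sum]
          simp only [Finset.sum_product, Finset.sum_const, Finset.card_univ, Fintype.card_fin,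
            Finset.card_range, nsmul_eq_mul]
          push_cast
          ring
      _ ≤ (Q + 1) * (K * (8 / 5 / (K * p.T ^ 2) * 2)) := by
          have := sum_inv_sq_le_two M
          gcongr
      _ = 16 / 5 * (Q + 1) / p.T ^ 2 := by
          field_simp
          norm_num
      _ ≤ _ := by
          gcongr
          norm_num
  refine (measureReal_union_le _ _).trans ((add_le_add h1 h2).trans (le_of_eq ?_))
  rw [add_div]

end

/-! ### The regret bound -/

/-- The constant in the bound for the cost of the estimation period. -/
def costFactor (κ z : ℝ) : ℝ := phaseFactor κ z * (z / (z - 1))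

/-- The constant in the bound for the regret on accurate rewards. -/
def runFactor (κ z w : ℝ) : ℝ :=
  54 * z ^ 3 + 6 * costFactor κ z + 268 + (w + 2) * (6 * Real.log (w + 2) + 24)
    + (54 * z ^ 3 + 2)

/-- The constant in the bound for the regret. -/
def regretFactor (κ z w : ℝ) : ℝ := runFactor κ z w + 200 + 2 * costFactor κ z

lemma oraclePayoff_le {m T : ℝ} (hT : 0 < T) : oraclePayoff m T ≤ m ^ 2 * T / 4 := by
  refine ciSup_le fun N => ?_
  have h1 : m ^ 2 * T / 4 - (m * N - (N : ℝ) ^ 2 / T) = (m * T / 2 - N) ^ 2 / T := by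
    field_simp
    ring
  have : 0 ≤ (m * T / 2 - N) ^ 2 / T := by positivity
  linarith

/-! ### Comparison of each contribution with the leading term -/

section

variable {p : Params} {z : ℝ}

lemma Params.Admissible.costFactor_pos (h : p.Admissible z) : 0 < costFactor p.κ z := by
  have := h.phaseFactor_pos
  have := h.z_pos
  have : 0 < z - 1 := by linarith [h.one_lt]
  unfold costFactor
  positivity

variable {K : ℕ} {m Δ : ℝ}

lemma le_mainTerm_left (K : ℕ) (m Δ T : ℝ) : m * K / Δ ^ 2 * Real.log T ≤ mainTerm K m Δ T :=
  le_max_left _ _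

lemma le_mainTerm_middle (K : ℕ) (m Δ T : ℝ) : (K : ℝ) ^ 2 * Real.log T ^ 2 / m ≤ mainTerm K m Δ T := by
  refine le_trans (le_of_eq ?_) ((le_max_left _ _).trans (le_max_right _ _))
  ring

lemma le_mainTerm_right (K : ℕ) (m Δ T : ℝ) : Real.log T ^ 2 / m ≤ mainTerm K m Δ T :=
  (le_max_right _ _).trans (le_max_right _ _)

lemma Params.Admissible.one_le_sq_mul_log_sq (h : p.Admissible z) (hK : 2 ≤ K) :
    1 ≤ (K : ℝ) ^ 2 * Real.log p.T ^ 2 := by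
  have hK' : (2 : ℝ) ≤ K := by exact_mod_cast hK
  have hL := h.log_lower
  rw [← mul_pow]
  exact one_le_pow₀ (by nlinarith)

lemma one_div_le_mainTerm (h : p.Admissible z) (hK : 2 ≤ K) (hm : 0 < m) :
    1 / m ≤ mainTerm K m Δ p.T := by
  refine le_trans ?_ (le_mainTerm_middle K m Δ p.T)
  have := h.one_le_sq_mul_log_sq hK
  gcongr

/-- The constants are absorbed into y = L/Δ² ≥ 0.69, where K ≥ 2 handles the final round. -/
lemma identify_term_le (h : p.Admissible z) (hK : 2 ≤ K) (hm : 0 < m) (hΔ : 0 < Δ) (hΔ1 : Δ ≤ 1) :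
    2 * m * (K + 2 * (K * lucbCount p.T Δ + 1)) ≤ 268 * mainTerm K m Δ p.T := by
  have hK' : (2 : ℝ) ≤ K := by exact_mod_cast hK
  have hL := h.log_lower
  have hL0 : 0 ≤ Real.log p.T := by linarith
  have h1 : (lucbCount p.T Δ : ℝ) ≤ 64 * (Real.log p.T / Δ ^ 2) + 1 := by
    unfold lucbCount
    push_cast
    have := Nat.floor_le (a := 8 * (8 * Real.log p.T) / Δ ^ 2) (by positivity)
    have h2 : 8 * (8 * Real.log p.T) / Δ ^ 2 = 64 * (Real.log p.T / Δ ^ 2) := by ring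
    linarith
  have h2 : Real.log p.T ≤ Real.log p.T / Δ ^ 2 := by
    rw [le_div_iff₀ (by positivity)]
    have : Δ ^ 2 ≤ 1 := pow_le_one₀ hΔ.le hΔ1
    nlinarith
  set y := Real.log p.T / Δ ^ 2 with hy
  calc 2 * m * (K + 2 * (K * lucbCount p.T Δ + 1))
      ≤ 2 * m * (K + 2 * (K * (64 * y + 1) + 1)) := by gcongr
    _ ≤ 2 * m * (K * (134 * y)) := by
        have : (K : ℝ) + 2 * (K * (64 * y + 1) + 1) ≤ K * (134 * y) := by nlinarith
        gcongr
    _ = 268 * (m * K / Δ ^ 2 * Real.log p.T) := by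
        rw [hy]
        ring
    _ ≤ _ := by
        gcongr
        exact le_mainTerm_left _ _ _ _

/-- The polynomial bound is for log M, where only its order L matters. The nearly linear one is for
the union bound, where M is multiplied by 1/T. -/
lemma playBound_le {Q : ℕ} (h : p.Admissible z) (hm : 0 < m) (hm1 : m ≤ 1) (hmT : 1 ≤ m * p.T)
    (hQ : (Q : ℝ) ≤ 29 * Real.log p.T / m ^ 2) :
    ((Q + ⌈p.T⌉₊ : ℕ) : ℝ) ≤ p.T ^ 8 ∧
      ((Q + ⌈p.T⌉₊ : ℕ) : ℝ) ≤ 32 * (Real.log p.T / m) * p.T := by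
  have hT := h.T_pos
  have hT2 := h.two_le
  have hL := h.log_lower
  have hL0 : 0 ≤ Real.log p.T := by linarith
  have hLT : Real.log p.T ≤ p.T := by
    have := Real.log_le_sub_one_of_pos hT
    linarith
  have h1 : ((Q + ⌈p.T⌉₊ : ℕ) : ℝ) ≤ 29 * Real.log p.T / m ^ 2 + (p.T + 1) := by
    push_cast
    have := Nat.ceil_lt_add_one hT.le
    linarith
  have h2 : 1 / m ≤ p.T := by
    rw [div_le_iff₀ hm]
    linarith
  constructor
  · calc _ ≤ _ := h1
      _ = 29 * Real.log p.T * (1 / m) ^ 2 + (p.T + 1) := by ring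
      _ ≤ 29 * p.T * p.T ^ 2 + (p.T + 1) := by gcongr
      _ ≤ 32 * p.T ^ 3 := by nlinarith [pow_pos hT 2, pow_pos hT 3]
      _ ≤ p.T ^ 5 * p.T ^ 3 := by
          have : (2 : ℝ) ^ 5 ≤ p.T ^ 5 := by gcongr
          gcongr
          linarith
      _ = _ := by ring
  · have h3 : Real.log p.T ≤ Real.log p.T / m := by
      rw [le_div_iff₀ hm]
      nlinarith
    have h4 : 29 * Real.log p.T / m ^ 2 ≤ 29 * (Real.log p.T / m) * p.T := by
      calc 29 * Real.log p.T / m ^ 2 = 29 * (Real.log p.T / m) * (1 / m) := by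
            field_simp
        _ ≤ _ := by gcongr
    nlinarith

lemma exploit_term_le (h : p.Admissible z) {M : ℕ} {w : ℝ} (hw : 0 < w) (hm : 0 < m) (hM1 : 1 ≤ M)
    (hM : (M : ℝ) ≤ p.T ^ 8) :
    exploitRate p w m * Real.log ((w + 2) * M)
      ≤ (w + 2) * (6 * Real.log (w + 2) + 24) * mainTerm K m Δ p.T := by
  have hL := h.log_lower
  have hM1' : (1 : ℝ) ≤ M := by exact_mod_cast hM1
  have hlw : 0 ≤ Real.log (w + 2) := Real.log_nonneg (by linarith)
  have h1 : Real.log ((w + 2) * M) ≤ (2 * Real.log (w + 2) + 8) * Real.log p.T := by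
    rw [Real.log_mul (by positivity) (by positivity)]
    have h2 : Real.log M ≤ 8 * Real.log p.T := by
      have := Real.log_le_log (by linarith) hM
      rw [Real.log_pow] at this
      exact_mod_cast this
    nlinarith
  have h3 := h.log_two_div_delta_le
  have h4 := h.one_lt_log_two_div_delta
  have h5 : 0 ≤ Real.log ((w + 2) * M) := Real.log_nonneg (by nlinarith)
  unfold exploitRate
  calc (w + 2) * (Real.log (2 / p.δ) / m) * Real.log ((w + 2) * M)
      ≤ (w + 2) * (3 * Real.log p.T / m) * ((2 * Real.log (w + 2) + 8) * Real.log p.T) := by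
        gcongr
    _ = (w + 2) * (6 * Real.log (w + 2) + 24) * (Real.log p.T ^ 2 / m) := by ring
    _ ≤ _ := by
        gcongr
        exact le_mainTerm_right _ _ _ _

lemma runRegret_le (h : p.Admissible z) (hK : 2 ≤ K) (hm : 0 < m) (hΔ : 0 < Δ)
    (hΔ1 : Δ ≤ 1) {M : ℕ} {w : ℝ} (hw : 0 < w) (hM1 : 1 ≤ M) (hM : (M : ℝ) ≤ p.T ^ 8) :
    runRegret K p z m Δ w M + m ^ 2 / 4 * gapBound z m
      ≤ runFactor p.κ z w * mainTerm K m Δ p.T := by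
  have h1 := identify_term_le h hK hm hΔ hΔ1
  have h2 := exploit_term_le (K := K) (Δ := Δ) h hw hm hM1 hM
  have h3 := one_div_le_mainTerm (Δ := Δ) h hK hm
  have h4 := le_mainTerm_middle K m Δ p.T
  have hz := h.z_pos
  have hD := h.costFactor_pos
  have h5 : estimateRegret K p z m
      = 54 * z ^ 3 * (1 / m)
        + 6 * costFactor p.κ z * ((K : ℝ) ^ 2 * Real.log p.T ^ 2 / m) := by
    unfold estimateRegret costFactor
    field_simp
    ring
  have h6 : m ^ 2 / 4 * gapBound z m = (54 * z ^ 3 + 3 / 2) * (1 / m) := by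
    unfold gapBound
    field_simp
    ring
  have h7 : 54 * z ^ 3 * (1 / m) ≤ 54 * z ^ 3 * mainTerm K m Δ p.T := by gcongr
  have h8 : 6 * costFactor p.κ z * ((K : ℝ) ^ 2 * Real.log p.T ^ 2 / m)
      ≤ 6 * costFactor p.κ z * mainTerm K m Δ p.T := by gcongr
  have h9 : (54 * z ^ 3 + 3 / 2) * (1 / m) ≤ (54 * z ^ 3 + 2) * mainTerm K m Δ p.T := by
    gcongr
    norm_num
  unfold runRegret identifyRegret runFactor
  rw [h5, h6]
  linarith

lemma cost_le_mainTerm (h : p.Admissible z) {Y : ℝ} (hY : Y ≤ 1 / m) :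
    (K : ℝ) ^ 2 * Real.log p.T ^ 2 * (costFactor p.κ z * Y)
      ≤ costFactor p.κ z * mainTerm K m Δ p.T := by
  have hD := h.costFactor_pos
  have := le_mainTerm_middle K m Δ p.T
  calc (K : ℝ) ^ 2 * Real.log p.T ^ 2 * (costFactor p.κ z * Y)
      ≤ (K : ℝ) ^ 2 * Real.log p.T ^ 2 * (costFactor p.κ z * (1 / m)) := by gcongr
    _ = costFactor p.κ z * ((K : ℝ) ^ 2 * Real.log p.T ^ 2 / m) := by ring
    _ ≤ _ := by gcongr

lemma badEvent_term_le (h : p.Admissible z) (hK : 2 ≤ K) (hm : 0 < m) {Q M : ℕ}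
    (hQM : Q + 1 ≤ M) (hM : (M : ℝ) ≤ 32 * (Real.log p.T / m) * p.T) :
    2 * p.T * ((K * M + 4 * (Q + 1)) / p.T ^ 2) ≤ 192 * mainTerm K m Δ p.T := by
  have hT := h.T_pos
  have hL := h.log_lower
  have hK' : (2 : ℝ) ≤ K := by exact_mod_cast hK
  have hQM' : (Q : ℝ) + 1 ≤ M := by exact_mod_cast hQM
  have h1 : (K : ℝ) * M + 4 * (Q + 1) ≤ 3 * (K * M) := by nlinarith
  have h2 : (K : ℝ) * Real.log p.T ≤ (K : ℝ) ^ 2 * Real.log p.T ^ 2 := by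
    have : 1 ≤ (K : ℝ) * Real.log p.T := by nlinarith
    nlinarith
  calc 2 * p.T * ((K * M + 4 * (Q + 1)) / p.T ^ 2)
      ≤ 2 * p.T * (3 * (K * (32 * (Real.log p.T / m) * p.T)) / p.T ^ 2) := by
        have : 3 * ((K : ℝ) * M) ≤ 3 * (K * (32 * (Real.log p.T / m) * p.T)) := by gcongr
        gcongr
        exact h1.trans this
    _ = 192 * ((K : ℝ) * Real.log p.T / m) := by
        field_simp
        norm_num
    _ ≤ 192 * ((K : ℝ) ^ 2 * Real.log p.T ^ 2 / m) := by gcongr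
    _ ≤ _ := by
        gcongr
        exact le_mainTerm_middle _ _ _ _

/-- In these degenerate cases the trivial loss 2T is already of the order of 1/m or of K²L²/m. -/
lemma horizon_le_mainTerm (h : p.Admissible z) (hK : 2 ≤ K) (hm : 0 < m) (hm1 : m ≤ 1)
    (hcase : m * p.T < 1 ∨ p.T < K) : 2 * p.T ≤ 6 * mainTerm K m Δ p.T := by
  have h1 := one_div_le_mainTerm (Δ := Δ) h hK hm
  have h2 := le_mainTerm_middle K m Δ p.T
  have hT := h.T_pos
  rcases hcase with hc | hc
  · have : p.T ≤ 1 / m := by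
      rw [le_div_iff₀ hm]
      linarith
    linarith
  · have hL := h.log_lower
    have hK' : (2 : ℝ) ≤ K := by exact_mod_cast hK
    have h3 : (K : ℝ) ≤ 3 * ((K : ℝ) ^ 2 * Real.log p.T ^ 2) := by
      have h4 : 0.4 ≤ Real.log p.T ^ 2 := by nlinarith
      nlinarith [mul_nonneg (sq_nonneg (K : ℝ)) (by linarith : 0 ≤ Real.log p.T ^ 2 - 0.4)]
    have h5 : (K : ℝ) ^ 2 * Real.log p.T ^ 2 ≤ (K : ℝ) ^ 2 * Real.log p.T ^ 2 / m := by
      rw [le_div_iff₀ hm]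
      have : 0 ≤ (K : ℝ) ^ 2 * Real.log p.T ^ 2 := by positivity
      nlinarith
    linarith

end

/-! ### Expectation over accurate and inaccurate tables -/

section

variable {K : ℕ} [NeZero K] {p : Params} {z : ℝ} {μ : Fin K → ℝ} {k₀ : Fin K} {Δ w : ℝ}
  {Ω : Type*} [MeasurableSpace Ω] {P : Measure Ω} [IsProbabilityMeasure P]
  {X : Fin K → ℕ → Ω → Bool}

lemma regret_le_of_pow_le (h : p.Admissible z) (hμ : BestArm μ k₀ Δ) {x : Rewards K} {Z : ℝ}
    (hZ0 : 0 ≤ Z)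
    (hZ : ∀ b j r q, state p x b = .estimate (j + 1) r q → startTime (blocks p x) b ≤ p.T →
      z ^ j ≤ Z) :
    μ k₀ ^ 2 * p.T / 4 - payoff μ p.T (blocks p x)
      ≤ 2 * p.T + (K : ℝ) ^ 2 * Real.log p.T ^ 2 * (costFactor p.κ z * Z) := by
  have h1 := le_partialPayoff h hμ.nonneg hZ0 hZ (blockBound p z)
  have h2 := min_le_right (startTime (blocks p x) (blockBound p z)) p.T
  have h3 : μ k₀ ^ 2 ≤ 1 := pow_le_one₀ (hμ.nonneg k₀) (hμ.lt_one k₀).le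
  have hT := h.T_pos
  rw [payoff_eq_partialPayoff h hμ.two_le]
  unfold costFactor
  nlinarith

/-- The regret of CTMAB is at most a constant times the leading term. -/
theorem expected_regret_le (h : p.Admissible z) (hμ : BestArm μ k₀ Δ) (hw : 0 < w)
    (hwidth : p.T ^ p.ν ≤ w / μ k₀ ^ 3)
    (hX : ∀ a n, Measurable (X a n))
    (hind : iIndepFun (fun i : Fin K × ℕ => X i.1 i.2) P)
    (hmean : ∀ a n, P.real {ω | X a n ω = true} = μ a) :
    oraclePayoff (μ k₀) p.T - ∫ ω, payoff μ p.T (blocks p fun a n => X a n ω) ∂P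
      ≤ regretFactor p.κ z w * mainTerm K (μ k₀) Δ p.T := by
  set m := μ k₀ with hmdef
  set main := mainTerm K m Δ p.T with hmain
  have hK := hμ.two_le
  have hK1 : 1 ≤ K := by omega
  have hm : 0 < m := hμ.mean_pos
  have hm1 : m ≤ 1 := (hμ.lt_one k₀).le
  have hΔ1 : Δ ≤ 1 := hμ.gap_le_mean.trans hm1
  have hT := h.T_pos
  have hT2 := h.two_le
  have hL := h.log_lower
  have hD := h.costFactor_pos
  have hmain0 : 1 ≤ main := by
    refine le_trans ?_ (one_div_le_mainTerm (Δ := Δ) h hK hm)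
    rw [le_div_iff₀ hm]
    linarith
  -- The least number of plays that forces the estimation period to end on accurate rewards;
  -- rounding up turns 27 L/m² into 29 L/m².
  set Q := ⌈9 * Real.log (2 / p.δ) / m ^ 2⌉₊ with hQdef
  have hl := h.one_lt_log_two_div_delta
  have hleQ : 9 * Real.log (2 / p.δ) ≤ Q * m ^ 2 := by
    have := Nat.le_ceil (9 * Real.log (2 / p.δ) / m ^ 2)
    rwa [div_le_iff₀ (by positivity)] at this
  have hQle : (Q : ℝ) ≤ 29 * Real.log p.T / m ^ 2 := by
    have h1 := Nat.ceil_lt_add_one (a := 9 * Real.log (2 / p.δ) / m ^ 2) (by positivity)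
    have h2 : 9 * Real.log (2 / p.δ) / m ^ 2 ≤ 9 * (3 * Real.log p.T) / m ^ 2 := by
      have := h.log_two_div_delta_le
      gcongr
    have h3 : 1 ≤ 2 * Real.log p.T / m ^ 2 := by
      rw [le_div_iff₀ (by positivity)]
      have : m ^ 2 ≤ 1 := pow_le_one₀ hm.le hm1
      linarith
    have h4 : 29 * Real.log p.T / m ^ 2
        = 9 * (3 * Real.log p.T) / m ^ 2 + 2 * Real.log p.T / m ^ 2 := by ring
    linarith
  have hQ1 : 1 ≤ Q := Nat.ceil_pos.2 (by positivity)
  set M := Q + ⌈p.T⌉₊ with hMdef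
  have hceil : 0 < ⌈p.T⌉₊ := Nat.ceil_pos.2 hT
  set E := inaccurate p.δ μ X k₀ Q with hE
  set A := (K : ℝ) ^ 2 * Real.log p.T ^ 2 * (costFactor p.κ z * (2 * p.T)) with hA
  have hA0 : 0 ≤ A := by positivity
  have hEmeas : MeasurableSet E := measurableSet_inaccurate hX _ _ _
  have hEprob : P.real E ≤ 1 / p.T ^ 2 := measure_inaccurate_le h hX hind hmean k₀ hQ1
  -- The cost on E has a factor T, but E is one event of probability at most 1/T², without a union
  -- bound; since m ≤ T, the remaining 1/T is at most 1/m.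
  have hAE : A * P.real E ≤ 2 * costFactor p.κ z * main := by
    calc A * P.real E ≤ A * (1 / p.T ^ 2) := by gcongr
      _ = 2 * ((K : ℝ) ^ 2 * Real.log p.T ^ 2 * (costFactor p.κ z * (1 / p.T))) := by
          rw [hA]
          field_simp
      _ ≤ 2 * (costFactor p.κ z * main) := by
          have : 1 / p.T ≤ 1 / m := by
            gcongr
            linarith
          have := cost_le_mainTerm (K := K) (Δ := Δ) h this
          gcongr
      _ = _ := by ring
  set x : Ω → Rewards K := fun ω a n => X a n ω with hx
  set f : Ω → ℝ := fun ω => m ^ 2 * p.T / 4 - payoff μ p.T (blocks p (x ω)) with hf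
  have hint : Integrable (fun ω => payoff μ p.T (blocks p (x ω))) P :=
    integrable_payoff h hK μ P hX
  have hfint : Integrable f P := (integrable_const _).sub hint
  have hreg : oraclePayoff m p.T - ∫ ω, payoff μ p.T (blocks p (x ω)) ∂P ≤ ∫ ω, f ω ∂P := by
    rw [hf, integral_sub (integrable_const _) hint]
    have := oraclePayoff_le (m := m) hT
    simp only [integral_const, probReal_univ, smul_eq_mul, one_mul]
    linarith
  refine hreg.trans ?_
  have hcrude : ∀ ω, f ω ≤ 2 * p.T + A := fun ω =>
    regret_le_of_pow_le h hμ (by positivity) fun b j r q hb hT => pow_le_of_startTime_le h hb hT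
  -- Accuracy at the single count Q for the best arm already ends the estimation period in time; no
  -- other accuracy is used.
  have hmid : ∀ ω ∉ E, f ω ≤ 2 * p.T + 6 * costFactor p.κ z * main := fun ω hω => by
    have hacc : |empMean (x ω) k₀ Q - μ k₀| < 3 / 4 * Real.sqrt (Real.log (2 / p.δ) / Q) := by
      rw [hE, inaccurate, Set.mem_ofPred_eq, not_le] at hω
      exact hω
    have hend := estStop_of_accurate h hμ hleQ hacc
    refine (regret_le_of_pow_le h hμ (Z := 6 / m) (by positivity) fun b j r q hb _ =>
      pow_le_of_estStop h hμ hQ1 hQle hend hb).trans ?_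
    have h1 := cost_le_mainTerm (K := K) (Δ := Δ) h (le_refl (1 / m))
    have h2 : (K : ℝ) ^ 2 * Real.log p.T ^ 2 * (costFactor p.κ z * (6 / m))
        = 6 * ((K : ℝ) ^ 2 * Real.log p.T ^ 2 * (costFactor p.κ z * (1 / m))) := by ring
    rw [h2]
    linarith
  have hlw : 0 ≤ (w + 2) * (6 * Real.log (w + 2) + 24) := by
    have : 0 ≤ Real.log (w + 2) := Real.log_nonneg (by linarith)
    positivity
  have hz3 : 0 < z ^ 3 := pow_pos h.z_pos 3
  have hrunF : 6 * costFactor p.κ z ≤ runFactor p.κ z w := by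
    unfold runFactor
    linarith
  have hrunF' : 6 * costFactor p.κ z * main ≤ runFactor p.κ z w * main := by gcongr
  have hindE : Integrable (fun ω => A * E.indicator (fun _ => (1 : ℝ)) ω) P :=
    ((integrable_const _).indicator hEmeas).const_mul _
  have hintE : ∫ ω, A * E.indicator (fun _ => (1 : ℝ)) ω ∂P = A * P.real E := by
    rw [integral_const_mul, integral_indicator_const _ hEmeas]
    simp
  by_cases hcase : m * p.T < 1 ∨ p.T < K
  · have h1 := horizon_le_mainTerm (Δ := Δ) h hK hm hm1 hcase
    have hpt : ∀ ω, f ω ≤ (6 * main + 6 * costFactor p.κ z * main)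
        + A * E.indicator (fun _ => (1 : ℝ)) ω := fun ω => by
      by_cases hω : ω ∈ E
      · rw [Set.indicator_of_mem hω]
        have h2 := hcrude ω
        have h3 : 0 ≤ 6 * costFactor p.κ z * main := by positivity
        linarith
      · rw [Set.indicator_of_notMem hω]
        have h2 := hmid ω hω
        linarith
    calc ∫ ω, f ω ∂P ≤ ∫ ω, ((6 * main + 6 * costFactor p.κ z * main)
          + A * E.indicator (fun _ => (1 : ℝ)) ω) ∂P :=
          integral_mono hfint ((integrable_const _).add hindE) hpt
      _ = (6 * main + 6 * costFactor p.κ z * main) + A * P.real E := by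
          rw [integral_add (integrable_const _) hindE, hintE]
          simp
      _ ≤ _ := by
          unfold regretFactor
          linarith
  · push Not at hcase
    obtain ⟨hmT, hKT⟩ := hcase
    obtain ⟨hM8, hMT⟩ := playBound_le h hm hm1 hmT hQle
    set B := badEvent p.δ μ X Q M with hB
    have hBmeas : MeasurableSet B := measurableSet_badEvent hX _ _ _
    have hBprob : P.real B ≤ (K * M + 4 * (Q + 1)) / p.T ^ 2 :=
      measure_badEvent_le h hK1 hX hind hmean Q M
    have hTB : 2 * p.T * P.real B ≤ 192 * main := by
      refine le_trans ?_ (badEvent_term_le (Δ := Δ) h hK hm (by omega : Q + 1 ≤ M) hMT)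
      gcongr
    have hgood : ∀ ω ∉ B, f ω ≤ runFactor p.κ z w * main := fun ω hω => by
      rw [hB, badEvent, Set.mem_union, not_or] at hω
      obtain ⟨hω1, hω2⟩ := hω
      simp only [Set.mem_iUnion, not_exists] at hω1 hω2
      have g : GoodRun p z (x ω) μ k₀ Δ w Q M := {
        adm := h
        best := hμ
        w_pos := hw
        width_le := hwidth
        le_Q := hleQ
        Q_le := hQle
        le_M := by
          rw [hMdef]
          push_cast
          linarith [Nat.le_ceil p.T]
        K_le := hKT
        accurate := fun a n hn hnM => by
          have h1 := hω1 (a, n) (by simp [hn, hnM])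
          rw [inaccurate, Set.mem_ofPred_eq, not_le] at h1
          exact h1
        lucb := fun q hq a u hu huM => by
          have h1 := hω2 (q, a, u) (by simp [hu, huM, hq])
          rw [lucbInaccurate, Set.mem_ofPred_eq, not_lt] at h1
          exact h1 }
      exact g.regret_le.trans (runRegret_le h hK hm hμ.gap_pos hΔ1 hw g.one_le_M hM8)
    have hpt : ∀ ω, f ω ≤ runFactor p.κ z w * main
        + 2 * p.T * B.indicator (fun _ => (1 : ℝ)) ω
        + A * E.indicator (fun _ => (1 : ℝ)) ω := fun ω => by
      have hind0 : 0 ≤ A * E.indicator (fun _ => (1 : ℝ)) ω :=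
        mul_nonneg hA0 (Set.indicator_nonneg (fun _ _ => zero_le_one) ω)
      have hrun0 : 0 ≤ runFactor p.κ z w * main := by
        have : 0 ≤ 6 * costFactor p.κ z * main := by positivity
        linarith
      by_cases hωB : ω ∈ B
      · rw [Set.indicator_of_mem hωB]
        by_cases hω : ω ∈ E
        · rw [Set.indicator_of_mem hω]
          have h2 := hcrude ω
          linarith
        · have h2 := hmid ω hω
          linarith
      · rw [Set.indicator_of_notMem hωB]
        have h2 := hgood ω hωB
        linarith
    have hindB : Integrable (fun ω => 2 * p.T * B.indicator (fun _ => (1 : ℝ)) ω) P :=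
      ((integrable_const _).indicator hBmeas).const_mul _
    have hintB : ∫ ω, 2 * p.T * B.indicator (fun _ => (1 : ℝ)) ω ∂P = 2 * p.T * P.real B := by
      rw [integral_const_mul, integral_indicator_const _ hBmeas]
      simp
    have hindB' : Integrable
        (fun ω => runFactor p.κ z w * main + 2 * p.T * B.indicator (fun _ => (1 : ℝ)) ω) P :=
      (integrable_const _).add hindB
    calc ∫ ω, f ω ∂P ≤ ∫ ω, (runFactor p.κ z w * main
          + 2 * p.T * B.indicator (fun _ => (1 : ℝ)) ω
          + A * E.indicator (fun _ => (1 : ℝ)) ω) ∂P :=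
          integral_mono hfint (hindB'.add hindE) hpt
      _ = runFactor p.κ z w * main + 2 * p.T * P.real B + A * P.real E := by
          rw [integral_add hindB' hindE,
            integral_add (integrable_const _) hindB, hintE, hintB]
          simp
      _ ≤ _ := by
          unfold regretFactor
          linarith

end

end CTMAB

end

theorem theorem3 (κ c w : ℝ) (hκ : 1 < κ) (hc : 1 < c) (hw : 0 < w) :
    ∃ C : ℝ, 0 < C ∧ ∃ C' : ℝ → ℝ,
      ∀ (K : ℕ) [NeZero K] (hK : 2 ≤ K) (μ : Fin K → ℝ) (μ₁ Δ T ε ν : ℝ)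
        (Ω : Type*) [MeasurableSpace Ω] (P : Measure Ω) [IsProbabilityMeasure P]
        (X : Fin K → ℕ → Ω → Bool),
        StrictAnti μ → (∀ a, 0 ≤ μ a ∧ μ a < 1) →
        μ₁ = μ ⟨0, by omega⟩ → Δ = μ ⟨0, by omega⟩ - μ ⟨1, by omega⟩ →
        (∀ a n, Measurable (X a n)) →
        iIndepFun (fun i : Fin K × ℕ => X i.1 i.2) P →
        (∀ a n, P.real {ω | X a n ω = true} = μ a) →
        2 ≤ T → 0 < ε → ε < 1 → T ^ ε = c → 0 < ν → T ^ ν ≤ w / μ₁ ^ 3 →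
        ∀ B : Ω → ℕ → CTMAB.Block K,
        (∀ ω, B ω = CTMAB.blocks ⟨T, ε, κ, 1 / T ^ 2, ν⟩ (fun a n => X a n ω)) →
        ∀ R : ℝ, R = CTMAB.oraclePayoff μ₁ T - ∫ ω, CTMAB.payoff μ T (B ω) ∂P →
          (∀ ω, CTMAB.FinitelyManyPlays T (B ω)) ∧
          Integrable (fun ω => CTMAB.payoff μ T (B ω)) P ∧
          R ≤ C * CTMAB.mainTerm K μ₁ Δ T
                * ((1 - 1 / T ^ (1 + ν)) * (1 - 1 / T ^ 2))
              + C * T * (1 - (1 - 1 / T ^ (1 + ν)) * (1 - 1 / T ^ 2)) ∧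
          ∀ A : ℝ, (K : ℝ) / μ₁ ≤ A * (μ₁ / Δ ^ 2) →
            R ≤ C' A * (K * μ₁ * Real.log T ^ 2 / Δ ^ 2) := by
  set z : ℝ := c ^ (1 / 3 : ℝ) with hzdef
  have hz : 1 < z := Real.one_lt_rpow hc (by norm_num)
  have hz3 : z ^ 3 = c := by
    rw [hzdef, ← Real.rpow_natCast, ← Real.rpow_mul (by linarith)]
    norm_num
  set C₀ := CTMAB.regretFactor κ z w with hC₀
  have hz31 : 0 < z ^ 3 - 1 := by linarith
  have hC₀pos : 0 < C₀ := by
    have h1 : 0 < z - 1 := by linarith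
    have h2 : 0 ≤ Real.log (w + 2) := Real.log_nonneg (by linarith)
    rw [hC₀]
    unfold CTMAB.regretFactor CTMAB.runFactor CTMAB.costFactor CTMAB.phaseFactor
    positivity
  -- Since T ≥ 2, the product of the two factors is at least 1/2 · 3/4 ≥ 1/3, so tripling C₀
  -- compensates for it; the additional term is nonnegative and is dropped.
  refine ⟨3 * C₀, by positivity, fun A => C₀ * (2 + A), ?_⟩
  intro K _ hK μ μ₁ Δ T ε ν Ω _ P _ X hμ hμ01 hμ₁ hΔ hX hind hmean hT hε _ hTε hν hwidth B hB R hR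
  obtain rfl : B = fun ω => CTMAB.blocks ⟨T, ε, κ, 1 / T ^ 2, ν⟩ (fun a n => X a n ω) :=
    funext hB
  have adm : CTMAB.Params.Admissible ⟨T, ε, κ, 1 / T ^ 2, ν⟩ z :=
    ⟨hT, hκ, hz, by simpa [hz3] using hTε, rfl⟩
  have best : CTMAB.BestArm μ ⟨0, by omega⟩ Δ := {
    two_le := hK
    nonneg := fun a => (hμ01 a).1
    lt_one := fun a => (hμ01 a).2
    gap_pos := by
      rw [hΔ, sub_pos]
      exact hμ (by simp [Fin.lt_def])
    gap_le := fun a ha => by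
      have h1 : μ a ≤ μ ⟨1, by omega⟩ := hμ.antitone (by
        rw [Fin.le_def]
        have : a.val ≠ 0 := fun h0 => ha (Fin.ext h0)
        simp only
        omega)
      rw [hΔ]
      linarith }
  subst hμ₁
  have main := CTMAB.expected_regret_le (P := P) adm best hw hwidth hX hind hmean
  rw [← hR] at main
  have hm := best.mean_pos
  have hΔ0 := best.gap_pos
  set m := μ ⟨0, by omega⟩ with hmdef
  have hL : 0.69 ≤ Real.log T := adm.log_lower
  have hmain0 : 0 < CTMAB.mainTerm K m Δ T :=
    lt_of_lt_of_le (by positivity) (CTMAB.one_div_le_mainTerm (Δ := Δ) adm hK hm)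
  refine ⟨fun ω => CTMAB.finitelyManyPlays adm hK,
    CTMAB.integrable_payoff adm hK μ P hX, ?_, ?_⟩
  · have h1 : 1 / T ^ (1 + ν) ≤ 1 / 2 := by
      have : T ^ (1 : ℝ) ≤ T ^ (1 + ν) := Real.rpow_le_rpow_of_exponent_le (by linarith) (by linarith)
      rw [Real.rpow_one] at this
      gcongr
      linarith
    have h1' : 0 < 1 / T ^ (1 + ν) := by positivity
    have h2 : 1 / T ^ 2 ≤ 1 / 4 := by
      gcongr
      nlinarith
    have h2' : 0 < 1 / T ^ 2 := by positivity
    set s := 1 / T ^ (1 + ν)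
    set t := 1 / T ^ 2
    have h3 : 1 / 3 ≤ (1 - s) * (1 - t) := by nlinarith
    have h4 : (1 - s) * (1 - t) ≤ 1 := by nlinarith
    have h5 : 0 ≤ 3 * C₀ * T * (1 - (1 - s) * (1 - t)) :=
      mul_nonneg (by positivity) (by linarith)
    have h6 : C₀ * CTMAB.mainTerm K m Δ T
        ≤ 3 * C₀ * CTMAB.mainTerm K m Δ T * ((1 - s) * (1 - t)) := by
      have : 0 < C₀ * CTMAB.mainTerm K m Δ T := by positivity
      nlinarith
    exact main.trans (by linarith)
  · intro A hA
    have hK0 : (2 : ℝ) ≤ K := by exact_mod_cast hK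
    have hA0 : 0 < A := by
      have h1 : 0 < (K : ℝ) / m := by positivity
      have h2 : 0 < m / Δ ^ 2 := by positivity
      by_contra hA0
      linarith [mul_nonpos_of_nonpos_of_nonneg (not_lt.1 hA0) h2.le]
    set y := K * m * Real.log T ^ 2 / Δ ^ 2 with hy
    have hy0 : 0 < y := by positivity
    have h1 : m * K / Δ ^ 2 * Real.log T ≤ 2 * y := by
      have h2 : Real.log T ≤ 2 * Real.log T ^ 2 := by nlinarith
      calc m * K / Δ ^ 2 * Real.log T ≤ m * K / Δ ^ 2 * (2 * Real.log T ^ 2) := by gcongr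
        _ = 2 * y := by rw [hy]; ring
    have h2 : (K : ℝ) ^ 2 / m * Real.log T ^ 2 ≤ A * y := by
      calc (K : ℝ) ^ 2 / m * Real.log T ^ 2 = K / m * (K * Real.log T ^ 2) := by ring
        _ ≤ A * (m / Δ ^ 2) * (K * Real.log T ^ 2) := by gcongr
        _ = A * y := by rw [hy]; ring
    have h3 : Real.log T ^ 2 / m ≤ (K : ℝ) ^ 2 / m * Real.log T ^ 2 := by
      rw [div_mul_eq_mul_div]
      gcongr
      have : 1 ≤ (K : ℝ) ^ 2 := one_le_pow₀ (by linarith)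
      nlinarith [sq_nonneg (Real.log T)]
    have h4 : CTMAB.mainTerm K m Δ T ≤ (2 + A) * y := by
      have h5 : 0 < A * y := by positivity
      unfold CTMAB.mainTerm
      refine max_le ?_ (max_le ?_ ?_) <;> linarith
    calc R ≤ C₀ * CTMAB.mainTerm K m Δ T := main
      _ ≤ C₀ * ((2 + A) * y) := by gcongr
      _ = C₀ * (2 + A) * y := by ring
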